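/- Let $C>0$ and $\lambda>0$. Let $X$ be the set of all complex-valued $\psi\in H^1(\mathbb R)$ with $\int_{\mathbb R}\bigl(|\psi'(s)|^2+s^2|\psi(s)|^2\bigr)\,ds<\infty$, where $\psi'$ is the weak derivative and functions are identified when they agree almost everywhere. Put $\Sigma_1=\{\psi\in X:\int_{\mathbb R}|\psi|^2\,ds=1\}$ and, for $\psi\in X$, $$E_\lambda(\psi)=\int_{\mathbb R}|\psi'(s)|^2\,ds+\int_{\mathbb R}s^2|\psi(s)|^2\,ds+C\int_{\mathbb R}\sqrt{1+2\lambda|\psi(s)|^2}\,|\psi(s)|^2\,ds .$$ Let $E_{\min}=\inf\{E_\lambda(\psi):\psi\in\Sigma_1\}$ and let $\mathcal G_\lambda=\{\psi\in\Sigma_1:E_\lambda(\psi)=E_{\min}\}$ be the set of ground states. Then there is $\varphi_{\min}\in\mathcal G_\lambda$ whose continuous representative is real-valued, strictly positive on $\mathbb R$, even, strictly decreasing on $[0,\infty)$, and satisfies $\varphi_{\min}(0)=\max_{s\in\mathbb R}\varphi_{\min}(s)$. It is the only ground state that is real-valued and nonnegative almost everywhere; in particular it is the unique positive ground state. Moreover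 $$\mathcal G_\lambda=\{e^{i\theta}\varphi_{\min}:\theta\in\mathbb R\}.$$ -/

import Mathlib

open MeasureTheory
open scoped ContDiff

noncomputable section

namespace MunozDelgado

/-- The complex Hilbert space `L²(ℝ)` of (classes of) square-integrable functions `ℝ → ℂ`. -/
abbrev L2 : Type := Lp ℂ 2 (volume : Measure ℝ)

/-- `g ∈ L²(ℝ)` is a weak (distributional) derivative of `f ∈ L²(ℝ)`:
`∫ η' f = - ∫ η g` for every smooth compactly supported real test function `η`. -/
def HasWeakDeriv (f g : L2) : Prop :=
  ∀ η : ℝ → ℝ, ContDiff ℝ ∞ η → HasCompactSupport η →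
    ∫ s, deriv η s • f s = - ∫ s, η s • g s

/-- A weak derivative in `L²(ℝ)` is unique. -/
theorem HasWeakDeriv.unique {f g h : L2} (hg : HasWeakDeriv f g) (hh : HasWeakDeriv f h) :
    g = h := by
  refine Lp.ext ?_
  refine ae_eq_of_integral_contDiff_smul_eq ?_ ?_ ?_
  · exact (Lp.memLp g).locallyIntegrable (by norm_num)
  · exact (Lp.memLp h).locallyIntegrable (by norm_num)
  · intro η h1 h2
    have := (hg η h1 h2).symm.trans (hh η h1 h2)
    exact neg_injective this

/-- The Sobolev space `H¹(ℝ)` of complex-valued functions. -/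
def H1 : Set L2 := {ψ | ∃ g : L2, HasWeakDeriv ψ g}

open Classical in
/-- The weak derivative `ψ'` of `ψ ∈ H¹(ℝ)` (and `0` by convention when `ψ ∉ H¹(ℝ)`). -/
def weakDeriv (ψ : L2) : L2 := if h : ∃ g : L2, HasWeakDeriv ψ g then h.choose else 0

theorem HasWeakDeriv.weakDeriv_eq {f g : L2} (h : HasWeakDeriv f g) : weakDeriv f = g := by
  have hex : ∃ g : L2, HasWeakDeriv f g := ⟨g, h⟩
  rw [weakDeriv, dif_pos hex]
  exact hex.choose_spec.unique h

/-- The energy space: all `ψ ∈ H¹(ℝ)` with `∫ (|ψ'(s)|² + s²|ψ(s)|²) ds < ∞`. -/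
def X : Set L2 :=
  {ψ | ψ ∈ H1 ∧ Integrable (fun s : ℝ => ‖weakDeriv ψ s‖ ^ 2 + s ^ 2 * ‖ψ s‖ ^ 2)}

/-- The energy `E_λ(ψ) = ∫ |ψ'|² + ∫ s²|ψ|² + C ∫ √(1 + 2λ|ψ|²) |ψ|²`
(all three integrals converge for `ψ ∈ X`, since `X ⊆ L² ∩ L⁴`). -/
def energy (C lam : ℝ) (ψ : L2) : ℝ :=
  (∫ s, ‖weakDeriv ψ s‖ ^ 2) + (∫ s, s ^ 2 * ‖ψ s‖ ^ 2)
    + C * ∫ s, Real.sqrt (1 + 2 * lam * ‖ψ s‖ ^ 2) * ‖ψ s‖ ^ 2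

/-- The charge `Q(ψ) = ∫ |ψ|²`. -/
def charge (ψ : L2) : ℝ := ∫ s, ‖ψ s‖ ^ 2

/-- The constraint set `Σ₁ = {ψ ∈ X : Q(ψ) = 1}`. -/
def Sigma1 : Set L2 := {ψ | ψ ∈ X ∧ charge ψ = 1}

/-- The minimal energy `E_min = inf {E_λ(ψ) : ψ ∈ Σ₁}`. -/
def minEnergy (C lam : ℝ) : ℝ := sInf (energy C lam '' Sigma1)

/-- The set of ground states `𝒢_λ = {ψ ∈ Σ₁ : E_λ(ψ) = E_min}`. -/
def groundStates (C lam : ℝ) : Set L2 := {ψ | ψ ∈ Sigma1 ∧ energy C lam ψ = minEnergy C lam}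

end MunozDelgado

end

noncomputable section

namespace MunozDelgado

open Set Filter Topology

/-! Viewed as a function of the density ρ = |ψ|², the problem is strictly convex. The quadratic mean
m = √((|ψ|² + |χ|²)/2) averages the densities, so it respects the constraint and averages the
potential energy. By Cauchy–Schwarz, |m'|² is at most the average of |ψ'|² and |χ'|². The density
√(1 + 2λρ)ρ is strictly convex, with midpoint gap at least (a - b)²/(8λ), where a and b are the
values of √(1 + 2λρ) for the two densities. This is `exists_quadraticMean_energy_add_le`, and it
carries both existence and uniqueness.

Existence: the gap bounds the distance of any two nonnegative almost minimisers in L²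
(`exists_norm_sub_sq_lt`). The parallelogram law at the arithmetic mean then controls their
derivatives (`norm_weakDeriv_sub_sq_le`). A nonnegative minimising sequence is therefore Cauchy
together with its derivatives, and Fatou's lemma shows that the limit is a minimiser; no compact
embedding is needed.

Uniqueness: two ground states have zero gap, hence the same modulus
(`norm_ae_eq_of_mem_groundStates`).

Shape: the first variation makes ground states classical solutions of U'' = (x² + C f'(|U|²) - μ)U
with f = `nonlin`. Positivity follows from ODE uniqueness at a zero, and evenness from uniqueness
under reflection. Monotonicity follows from comparing the ODE at an outer maximum and an inner
minimum.

Phase: equal moduli force equal kinetic energies. In the equality case of |(|U|)'| ≤ |U'| the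
quotient of U by the positive profile has zero derivative (`IsRealProfile.exists_eq_exp_smul`). -/

/-! ### Absolutely continuous representatives and weak derivatives on the line. -/

theorem absolutelyContinuousOnInterval_of_dist_le {E F : Type*} [PseudoMetricSpace E]
    [PseudoMetricSpace F] {f : ℝ → E} {H : ℝ → F} {a b : ℝ}
    (hH : AbsolutelyContinuousOnInterval H a b)
    (h : ∀ x y, dist (f x) (f y) ≤ dist (H x) (H y)) :
    AbsolutelyContinuousOnInterval f a b := by
  rw [absolutelyContinuousOnInterval_iff] at hH ⊢
  intro ε hε
  obtain ⟨δ, hδ, hd⟩ := hH ε hε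
  exact ⟨δ, hδ, fun E hE hs => (Finset.sum_le_sum fun i _ => h _ _).trans_lt (hd E hE hs)⟩

/-- `U` is locally absolutely continuous with almost everywhere derivative `g`. -/
structure IsPrimitive (U g : ℝ → ℂ) : Prop where
  ac : ∀ a b, AbsolutelyContinuousOnInterval U a b
  loc : LocallyIntegrable g
  ae_deriv : ∀ᵐ x, HasDerivAt U (g x) x

theorem intervalIntegrable_of_loc {E : Type*} [NormedAddCommGroup E] {g : ℝ → E}
    (h : LocallyIntegrable g) (a b : ℝ) : IntervalIntegrable g volume a b :=
  (h.integrableOn_isCompact isCompact_uIcc).intervalIntegrable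

theorem locallyIntegrable_norm {E : Type*} [NormedAddCommGroup E] {g : ℝ → E}
    (h : LocallyIntegrable g) : LocallyIntegrable fun x => ‖g x‖ :=
  h.mono h.aestronglyMeasurable.norm (by simp)

/-- The indefinite integral of `k` is absolutely continuous and dominates the increments of `f`.
This also serves for the quadratic mean, whose increments are estimated before its derivative is
known. -/
theorem absolutelyContinuousOnInterval_of_dist_le_integral {E : Type*} [PseudoMetricSpace E]
    {f : ℝ → E} {k : ℝ → ℝ} (hk : LocallyIntegrable k)
    (h : ∀ x y, x ≤ y → dist (f x) (f y) ≤ ∫ t in x..y, k t) (a b : ℝ) :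
    AbsolutelyContinuousOnInterval f a b := by
  have hi := intervalIntegrable_of_loc hk
  refine absolutelyContinuousOnInterval_of_dist_le
    ((hi a b).absolutelyContinuousOnInterval_intervalIntegral left_mem_uIcc) ?_
  intro x y
  wlog hxy : x ≤ y generalizing x y
  · rw [dist_comm, dist_comm (∫ v in a..x, k v)]
    exact this y x (le_of_not_ge hxy)
  rw [Real.dist_eq, intervalIntegral.integral_interval_sub_left (hi _ _) (hi _ _),
    intervalIntegral.integral_symm, abs_neg]
  exact (h x y hxy).trans (le_abs_self _)

theorem isPrimitive_integral {g : ℝ → ℂ} (hg : LocallyIntegrable g) (c : ℂ) :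
    IsPrimitive (fun x => c + ∫ t in (0:ℝ)..x, g t) g := by
  have hi := intervalIntegrable_of_loc hg
  refine ⟨absolutelyContinuousOnInterval_of_dist_le_integral (locallyIntegrable_norm hg) ?_,
    hg, ?_⟩
  · intro x y hxy
    rw [dist_add_left, dist_comm, dist_eq_norm,
      intervalIntegral.integral_interval_sub_left (hi _ _) (hi _ _)]
    exact intervalIntegral.norm_integral_le_integral_norm hxy
  · filter_upwards [LocallyIntegrable.ae_hasDerivAt_integral hg] with x hx
    exact (hx 0).const_add c

namespace IsPrimitive

variable {U V g k : ℝ → ℂ}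

theorem sub (hU : IsPrimitive U g) (hV : IsPrimitive V k) : IsPrimitive (U - V) (g - k) :=
  ⟨fun a b => (hU.ac a b).sub (hV.ac a b), hU.loc.sub hV.loc, by
    filter_upwards [hU.ae_deriv, hV.ae_deriv] with x h1 h2 using h1.sub h2⟩

/-- The difference of the two sides is absolutely continuous with derivative zero almost everywhere,
hence constant. -/
theorem eq_add_integral (hU : IsPrimitive U g) (x : ℝ) :
    U x = U 0 + ∫ t in (0:ℝ)..x, g t := by
  have h := hU.sub (isPrimitive_integral hU.loc (U 0))
  obtain ⟨c, hc⟩ := (h.ac 0 x).const_of_ae_hasDerivAt_zero (by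
    filter_upwards [h.ae_deriv] with y hy _
    simpa using hy)
  have h0 := hc 0 left_mem_uIcc
  have h1 := hc x right_mem_uIcc
  simp only [Pi.sub_apply, intervalIntegral.integral_same, add_zero, sub_self] at h0 h1
  rw [← h0] at h1
  exact sub_eq_zero.mp h1

theorem sub_eq (hU : IsPrimitive U g) (x y : ℝ) : U y - U x = ∫ t in x..y, g t := by
  have hi := intervalIntegrable_of_loc hU.loc
  rw [hU.eq_add_integral y, hU.eq_add_integral x, add_sub_add_left_eq_sub,
    intervalIntegral.integral_interval_sub_left (hi _ _) (hi _ _)]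

theorem dist_le (hU : IsPrimitive U g) {x y : ℝ} (hxy : x ≤ y) :
    dist (U x) (U y) ≤ ∫ t in x..y, ‖g t‖ := by
  rw [dist_comm, dist_eq_norm, hU.sub_eq]
  exact intervalIntegral.norm_integral_le_integral_norm hxy

theorem continuous (hU : IsPrimitive U g) : Continuous U := by
  refine continuous_iff_continuousAt.2 fun x => ?_
  exact ((hU.ac (x - 1) (x + 1)).continuousOn).continuousAt
    (by rw [uIcc_of_le (by linarith)]; exact Icc_mem_nhds (by linarith) (by linarith))

theorem congr_right {g' : ℝ → ℂ} (hU : IsPrimitive U g) (h : g =ᵐ[volume] g') :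
    IsPrimitive U g' :=
  ⟨hU.ac, hU.loc.congr h, by
    filter_upwards [hU.ae_deriv, h] with x h1 h2
    rwa [← h2]⟩

theorem smul (hU : IsPrimitive U g) {η : ℝ → ℝ} (hη : ContDiff ℝ ∞ η) :
    IsPrimitive (η • U) (fun x => deriv η x • U x + η x • g x) := by
  have h1 : ContDiff ℝ 1 η := hη.of_le (by exact_mod_cast le_top)
  have hd : Continuous (deriv η) := h1.continuous_deriv le_rfl
  refine ⟨fun a b => h1.contDiffOn.absolutelyContinuousOnInterval.smul (hU.ac a b), ?_, ?_⟩
  · exact (hd.smul hU.continuous).locallyIntegrable.add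
      (by simpa using hU.loc.continuous_smul hη.continuous)
  · filter_upwards [hU.ae_deriv] with x hx
    have := (h1.differentiable one_ne_zero x).hasDerivAt.smul hx
    rwa [add_comm] at this

/-- Integration by parts: η • U is a primitive of η' • U + η • g and vanishes at the ends of a large
interval. -/
theorem integral_deriv_smul (hU : IsPrimitive U g) {η : ℝ → ℝ} (hη : ContDiff ℝ ∞ η)
    (hc : HasCompactSupport η) : ∫ s, deriv η s • U s = -∫ s, η s • g s := by
  have h := hU.smul hη
  have h1 : ContDiff ℝ 1 η := hη.of_le (by exact_mod_cast le_top)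
  have hd : Continuous (deriv η) := h1.continuous_deriv le_rfl
  have i1 : Integrable fun s => deriv η s • U s :=
    (hd.smul hU.continuous).integrable_of_hasCompactSupport (hc.deriv.smul_right)
  have i2 : Integrable fun s => η s • g s :=
    hU.loc.integrable_smul_left_of_hasCompactSupport hη.continuous hc
  obtain ⟨R, hR⟩ := hc.isCompact.isBounded.subset_closedBall 0
  have hz : ∀ x, x ∉ Ioc (-(|R| + 1)) (|R| + 1) → η x = 0 ∧ deriv η x = 0 := by
    intro x hx
    have hx' : x ∉ tsupport η := by
      intro hx'
      have := hR hx'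
      simp only [Metric.mem_closedBall, dist_zero_right, Real.norm_eq_abs] at this
      exact hx ⟨by linarith [neg_abs_le x, le_abs_self R], by linarith [le_abs_self x, le_abs_self R]⟩
    refine ⟨image_eq_zero_of_notMem_tsupport hx', ?_⟩
    exact image_eq_zero_of_notMem_tsupport fun h => hx' (tsupport_deriv_subset h)
  -- The interval is lengthened by one on each side so that `hz` applies at both end points; the
  -- right end of its half-open interval would not qualify.
  have h2 := h.sub_eq (-(|R| + 1) - 1) (|R| + 1 + 1)
  have h3 := (hz (-(|R| + 1) - 1) (fun h => by linarith [h.1])).1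
  have h4 := (hz (|R| + 1 + 1) (fun h => by linarith [h.2])).1
  rw [eq_neg_iff_add_eq_zero, ← integral_add i1 i2]
  simp only [Pi.smul_apply', h3, h4, zero_smul, sub_self] at h2
  rw [h2, intervalIntegral.integral_of_le (by linarith [abs_nonneg R]),
    setIntegral_eq_integral_of_forall_compl_eq_zero]
  intro x hx
  have := hz x (fun h => hx ⟨by linarith [h.1], by linarith [h.2]⟩)
  simp [this.1, this.2]

end IsPrimitive

/-- A test function with zero integral is the derivative of a test function. -/
theorem exists_deriv_eq_of_integral_eq_zero {χ : ℝ → ℝ} (hχ : ContDiff ℝ ∞ χ)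
    (hc : HasCompactSupport χ) (h0 : ∫ x, χ x = 0) :
    ∃ η : ℝ → ℝ, ContDiff ℝ ∞ η ∧ HasCompactSupport η ∧ deriv η = χ := by
  obtain ⟨R, hR⟩ := hc.isCompact.isBounded.subset_closedBall 0
  set r := |R| + 1
  have hz : ∀ x, x ∉ Ioo (-r) r → χ x = 0 := by
    intro x hx
    refine image_eq_zero_of_notMem_tsupport fun hx' => hx ?_
    have := hR hx'
    simp only [Metric.mem_closedBall, dist_zero_right, Real.norm_eq_abs] at this
    exact ⟨by linarith [neg_abs_le x, le_abs_self R], by linarith [le_abs_self x, le_abs_self R]⟩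
  have hr : -r ≤ r := by linarith [abs_nonneg R]
  have hd : ∀ x, HasDerivAt (fun x => ∫ t in (-r)..x, χ t) (χ x) x := fun x =>
    hχ.continuous.integral_hasStrictDerivAt _ _ |>.hasDerivAt
  have hd' : deriv (fun x => ∫ t in (-r)..x, χ t) = χ := funext fun x => (hd x).deriv
  refine ⟨fun x => ∫ t in (-r)..x, χ t, ?_, ?_, hd'⟩
  · rw [contDiff_infty_iff_deriv, hd']
    exact ⟨fun x => (hd x).differentiableAt, hχ⟩
  · refine HasCompactSupport.intro (isCompact_Icc (a := -r) (b := r)) fun x hx => ?_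
    rcases lt_or_ge x (-r) with h | h
    · refine intervalIntegral.integral_zero_ae (ae_of_all _ fun t ht => hz t fun ht' => ?_)
      rw [uIoc_of_ge h.le] at ht
      linarith [ht'.1, ht.2]
    · have hx : r < x := not_le.1 fun h' => hx ⟨h, h'⟩
      rw [intervalIntegral.integral_of_le h, setIntegral_eq_integral_of_forall_compl_eq_zero, h0]
      exact fun t ht => hz t fun ht' => ht ⟨ht'.1, ht'.2.le.trans hx.le⟩

/-- The du Bois-Reymond lemma. -/
theorem exists_isPrimitive_of_weak {f g : ℝ → ℂ} (hf : LocallyIntegrable f)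
    (hg : LocallyIntegrable g)
    (h : ∀ η : ℝ → ℝ, ContDiff ℝ ∞ η → HasCompactSupport η →
      ∫ s, deriv η s • f s = -∫ s, η s • g s) :
    ∃ U, IsPrimitive U g ∧ f =ᵐ[volume] U := by
  have hG := isPrimitive_integral hg 0
  set G : ℝ → ℂ := fun x => 0 + ∫ t in (0:ℝ)..x, g t
  have hl : LocallyIntegrable (f - G) := hf.sub hG.continuous.locallyIntegrable
  have hI : ∀ η : ℝ → ℝ, ContDiff ℝ ∞ η → HasCompactSupport η →
      ∫ s, deriv η s • (f - G) s = 0 := by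
    intro η h1 h2
    have hd : Continuous (deriv η) := (h1.of_le (by exact_mod_cast le_top)).continuous_deriv le_rfl
    simp only [Pi.sub_apply, smul_sub]
    rw [integral_sub (hf.integrable_smul_left_of_hasCompactSupport hd h2.deriv)
      (hG.continuous.locallyIntegrable.integrable_smul_left_of_hasCompactSupport hd h2.deriv),
      h η h1 h2, hG.integral_deriv_smul h1 h2, sub_self]
  let b : ContDiffBump (0 : ℝ) := ⟨1, 2, one_pos, one_lt_two⟩
  set η₀ := b.normed volume
  have hη₀ : ContDiff ℝ ∞ η₀ := b.contDiff_normed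
  have hs₀ : HasCompactSupport η₀ := b.hasCompactSupport_normed
  have hi₀ : ∫ x, η₀ x = 1 := b.integral_normed
  set c := ∫ s, η₀ s • (f - G) s
  refine ⟨fun x => c + ∫ t in (0:ℝ)..x, g t, isPrimitive_integral hg c, ?_⟩
  have key : (f - G) =ᵐ[volume] fun _ => c := by
    refine ae_eq_of_integral_contDiff_smul_eq hl (locallyIntegrable_const c) fun ζ hζ hζs => ?_
    have iζ := hζ.continuous.integrable_of_hasCompactSupport hζs (μ := volume)
    have i₀ := hη₀.continuous.integrable_of_hasCompactSupport hs₀ (μ := volume)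
    -- A test function ζ is (∫ζ) η₀ plus a test function of zero integral. The latter is a
    -- derivative, and f - G annihilates derivatives.
    obtain ⟨η, h1, h2, h3⟩ := exists_deriv_eq_of_integral_eq_zero
      (χ := fun x => ζ x - (∫ t, ζ t) * η₀ x) (hζ.sub (contDiff_const.mul hη₀))
      (hζs.sub hs₀.mul_left) (by
        rw [integral_sub iζ (i₀.const_mul _), integral_const_mul, hi₀, mul_one, sub_self])
    have h4 := hI η h1 h2
    simp only [h3, sub_smul, mul_smul] at h4
    have e := integral_sub (hl.integrable_smul_left_of_hasCompactSupport hζ.continuous hζs)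
      ((hl.integrable_smul_left_of_hasCompactSupport hη₀.continuous hs₀).smul (∫ t, ζ t))
    simp only [Pi.smul_apply] at e
    rw [e, integral_smul, sub_eq_zero] at h4
    rw [h4, integral_smul_const]
  filter_upwards [key] with x hx
  simp only [Pi.sub_apply, G, zero_add] at hx
  rw [← hx, sub_add_cancel]

/-! ### Quadratic means of absolutely continuous functions. -/

/-- The root mean square is the Euclidean norm on ℂ² divided by √2, so this is the reverse triangle
inequality. -/
theorem abs_sqrt_half_sub_le (a b c d : ℂ) :
    |√((‖a‖ ^ 2 + ‖b‖ ^ 2) / 2) - √((‖c‖ ^ 2 + ‖d‖ ^ 2) / 2)| ≤ ‖a - c‖ + ‖b - d‖ := by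
  have h1 : ∀ a b : ℂ, √((‖a‖ ^ 2 + ‖b‖ ^ 2) / 2) = ‖WithLp.toLp 2 (a, b)‖ / √2 := by
    intro a b
    rw [Real.sqrt_div (by positivity), WithLp.prod_norm_eq_of_L2]
    rfl
  have h2 : (1:ℝ) ≤ √2 := by rw [Real.one_le_sqrt]; norm_num
  rw [h1, h1, ← sub_div, abs_div, abs_of_nonneg (Real.sqrt_nonneg 2)]
  refine (div_le_self (abs_nonneg _) h2).trans ((abs_norm_sub_norm_le _ _).trans ?_)
  rw [← WithLp.toLp_sub, WithLp.prod_norm_eq_of_L2]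
  refine Real.sqrt_le_iff.2 ⟨by positivity, ?_⟩
  change ‖a - c‖ ^ 2 + ‖b - d‖ ^ 2 ≤ _
  nlinarith [norm_nonneg (a - c), norm_nonneg (b - d)]

theorem normSq_hasDerivAt {U : ℝ → ℂ} {g : ℂ} {x : ℝ} (h : HasDerivAt U g x) :
    HasDerivAt (fun y => ‖U y‖ ^ 2) (2 * (g * starRingEnd ℂ (U x)).re) x := by
  have := h.norm_sq
  rwa [Complex.inner] at this

theorem re_mul_conj_sq_le (g u : ℂ) : |(g * starRingEnd ℂ u).re| ≤ ‖g‖ * ‖u‖ := by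
  simpa using Complex.abs_re_le_norm (g * starRingEnd ℂ u)

/-- Here W is the quadratic mean of u and v, and r its derivative when u' = g and v' = k. Hypothesis
`h` is W² differentiated, and Cauchy–Schwarz bounds its right side; `h0` covers W = 0, where `h`
says nothing about r. -/
theorem sq_le_of_two_mul_eq_re_add_re {u v g k : ℂ} {W r : ℝ}
    (hW : W ^ 2 = (‖u‖ ^ 2 + ‖v‖ ^ 2) / 2)
    (h : 2 * (W * r) = (g * starRingEnd ℂ u).re + (k * starRingEnd ℂ v).re)
    (h0 : u = 0 → v = 0 → r = 0) : r ^ 2 ≤ (‖g‖ ^ 2 + ‖k‖ ^ 2) / 2 := by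
  rcases eq_or_lt_of_le (sq_nonneg W) with hW0 | hW0
  · have hu : ‖u‖ = 0 := by nlinarith [sq_nonneg ‖u‖, sq_nonneg ‖v‖]
    have hv : ‖v‖ = 0 := by nlinarith [sq_nonneg ‖u‖, sq_nonneg ‖v‖]
    rw [h0 (norm_eq_zero.1 hu) (norm_eq_zero.1 hv), zero_pow two_ne_zero]
    positivity
  · have h1 : |2 * (W * r)| ≤ ‖g‖ * ‖u‖ + ‖k‖ * ‖v‖ := by
      rw [h]
      exact (abs_add_le _ _).trans
        (add_le_add (re_mul_conj_sq_le _ _) (re_mul_conj_sq_le _ _))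
    have h2 : (2 * (W * r)) ^ 2 ≤ (‖g‖ * ‖u‖ + ‖k‖ * ‖v‖) ^ 2 := by
      rw [← sq_abs]
      exact pow_le_pow_left₀ (abs_nonneg _) h1 2
    have h3 : (‖g‖ * ‖u‖ + ‖k‖ * ‖v‖) ^ 2 ≤ (‖g‖ ^ 2 + ‖k‖ ^ 2) * (‖u‖ ^ 2 + ‖v‖ ^ 2) := by
      nlinarith [sq_nonneg (‖g‖ * ‖v‖ - ‖k‖ * ‖u‖)]
    have h4 : ‖u‖ ^ 2 + ‖v‖ ^ 2 = 2 * W ^ 2 := by rw [hW]; ring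
    rw [h4] at h3
    nlinarith

/-- The quadratic mean of two locally absolutely continuous functions. -/
theorem IsPrimitive.exists_quadraticMean {U V g k : ℝ → ℂ} (hU : IsPrimitive U g)
    (hV : IsPrimitive V k) :
    ∃ w : ℝ → ℝ, IsPrimitive (fun x => (√((‖U x‖ ^ 2 + ‖V x‖ ^ 2) / 2) : ℂ)) (fun x => (w x : ℂ)) ∧
      ∀ᵐ x, 2 * (√((‖U x‖ ^ 2 + ‖V x‖ ^ 2) / 2) * w x) =
          (g x * starRingEnd ℂ (U x)).re + (k x * starRingEnd ℂ (V x)).re ∧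
        (U x = 0 → V x = 0 → w x = 0) := by
  set W : ℝ → ℝ := fun x => √((‖U x‖ ^ 2 + ‖V x‖ ^ 2) / 2)
  have hloc : LocallyIntegrable fun t => ‖g t‖ + ‖k t‖ :=
    (locallyIntegrable_norm hU.loc).add (locallyIntegrable_norm hV.loc)
  have hWle : ∀ x y, x ≤ y → |W x - W y| ≤ ∫ t in x..y, (‖g t‖ + ‖k t‖) := by
    intro x y hxy
    refine (abs_sqrt_half_sub_le _ _ _ _).trans ?_
    rw [intervalIntegral.integral_add (intervalIntegrable_of_loc (locallyIntegrable_norm hU.loc) _ _)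
      (intervalIntegrable_of_loc (locallyIntegrable_norm hV.loc) _ _), ← dist_eq_norm,
      ← dist_eq_norm]
    exact add_le_add (hU.dist_le hxy) (hV.dist_le hxy)
  have hW : ∀ a b, AbsolutelyContinuousOnInterval W a b :=
    absolutelyContinuousOnInterval_of_dist_le_integral hloc hWle
  have hdiff : ∀ᵐ x, DifferentiableAt ℝ W x := by
    have : ∀ n : ℕ, ∀ᵐ x, x ∈ uIcc (-(n:ℝ)) n → DifferentiableAt ℝ W x := fun n =>
      (hW _ _).ae_differentiableAt
    filter_upwards [ae_all_iff.2 this] with x hx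
    obtain ⟨n, hn⟩ := exists_nat_ge |x|
    refine hx n ?_
    rw [uIcc_of_le (by linarith [abs_nonneg x])]
    exact abs_le.1 hn
  have hd : ∀ᵐ x, 2 * (W x * deriv W x) =
          (g x * starRingEnd ℂ (U x)).re + (k x * starRingEnd ℂ (V x)).re ∧
        (U x = 0 → V x = 0 → deriv W x = 0) := by
    filter_upwards [hdiff, hU.ae_deriv, hV.ae_deriv] with x h1 h2 h3
    constructor
    · have e1 := h1.hasDerivAt.pow 2
      have e2 := ((normSq_hasDerivAt h2).add (normSq_hasDerivAt h3)).div_const 2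
      have e3 : W ^ 2 = fun x => (‖U x‖ ^ 2 + ‖V x‖ ^ 2) / 2 := by
        funext y
        exact Real.sq_sqrt (by positivity)
      rw [e3] at e1
      have := e1.unique e2
      simp only [Nat.cast_ofNat, Nat.add_one_sub_one, pow_one] at this
      linarith
    · intro hu hv
      -- At a common zero the nonnegative function W attains its minimum.
      refine IsLocalMin.deriv_eq_zero (Eventually.of_forall fun y => ?_)
      have : W x = 0 := by simp [W, hu, hv]
      rw [this]
      exact Real.sqrt_nonneg _
  refine ⟨deriv W, ⟨fun a b => ?_, ?_, ?_⟩, hd⟩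
  · refine absolutelyContinuousOnInterval_of_dist_le_integral hloc (fun x y hxy => ?_) a b
    rw [Complex.dist_eq, ← Complex.ofReal_sub, Complex.norm_real]
    exact hWle x y hxy
  · refine hloc.mono (Complex.measurable_ofReal.comp (measurable_deriv W)).aestronglyMeasurable ?_
    filter_upwards [hd] with x hx
    rw [Complex.norm_real, Real.norm_of_nonneg (add_nonneg (norm_nonneg _) (norm_nonneg _))]
    have h := sq_le_of_two_mul_eq_re_add_re (Real.sq_sqrt (by positivity)) hx.1 hx.2
    refine abs_le_of_sq_le_sq (h.trans ?_) (by positivity)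
    nlinarith [norm_nonneg (g x), norm_nonneg (k x)]
  · filter_upwards [hdiff] with x hx
    exact hx.hasDerivAt.ofReal_comp

/-! ### The energy space and its linear structure. -/

theorem integrable_norm_sq (ψ : L2) : Integrable fun s => ‖ψ s‖ ^ 2 := by
  have := Lp.memLp ψ
  rwa [memLp_two_iff_integrable_sq_norm this.1] at this

theorem charge_eq_norm_sq (ψ : L2) : charge ψ = ‖ψ‖ ^ 2 := by
  rw [@norm_sq_eq_re_inner ℂ, L2.inner_def, charge, ← integral_re (L2.integrable_inner _ _)]
  congr 1 with s
  rw [inner_self_eq_norm_sq_to_K]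
  norm_cast

theorem L2.locallyIntegrable (ψ : L2) : LocallyIntegrable ψ :=
  (Lp.memLp ψ).locallyIntegrable (by norm_num)

theorem L2.integrable_smul (ψ : L2) {η : ℝ → ℝ} (hη : Continuous η) (hc : HasCompactSupport η) :
    Integrable fun s => η s • ψ s :=
  (L2.locallyIntegrable ψ).integrable_smul_left_of_hasCompactSupport hη hc

theorem continuous_deriv_of_contDiff {η : ℝ → ℝ} (h : ContDiff ℝ ∞ η) : Continuous (deriv η) :=
  (h.of_le (m := 1) (by exact_mod_cast le_top)).continuous_deriv le_rfl

namespace HasWeakDeriv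

variable {ψ χ g k : L2}

theorem exists_isPrimitive (h : HasWeakDeriv ψ g) : ∃ U, IsPrimitive U g ∧ ψ =ᵐ[volume] U :=
  exists_isPrimitive_of_weak (L2.locallyIntegrable ψ) (L2.locallyIntegrable g) h

theorem of_isPrimitive {U v : ℝ → ℂ} (h : IsPrimitive U v) (hU : ψ =ᵐ[volume] U)
    (hv : g =ᵐ[volume] v) : HasWeakDeriv ψ g := by
  intro η h1 h2
  have e1 : ∫ s, deriv η s • ψ s = ∫ s, deriv η s • U s :=
    integral_congr_ae (by filter_upwards [hU] with s hs; rw [hs])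
  have e2 : ∫ s, η s • g s = ∫ s, η s • v s :=
    integral_congr_ae (by filter_upwards [hv] with s hs; rw [hs])
  rw [e1, e2, h.integral_deriv_smul h1 h2]

theorem add (h : HasWeakDeriv ψ g) (h' : HasWeakDeriv χ k) : HasWeakDeriv (ψ + χ) (g + k) := by
  intro η h1 h2
  have hd := continuous_deriv_of_contDiff h1
  have e1 : ∫ s, deriv η s • (ψ + χ) s = ∫ s, (deriv η s • ψ s + deriv η s • χ s) :=
    integral_congr_ae (by
      filter_upwards [Lp.coeFn_add ψ χ] with s hs
      rw [hs, Pi.add_apply, smul_add])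
  have e2 : ∫ s, η s • (g + k) s = ∫ s, (η s • g s + η s • k s) :=
    integral_congr_ae (by
      filter_upwards [Lp.coeFn_add g k] with s hs
      rw [hs, Pi.add_apply, smul_add])
  rw [e1, e2, integral_add (L2.integrable_smul ψ hd h2.deriv) (L2.integrable_smul χ hd h2.deriv),
    integral_add (L2.integrable_smul g h1.continuous h2) (L2.integrable_smul k h1.continuous h2),
    h η h1 h2, h' η h1 h2, neg_add]

theorem smul (h : HasWeakDeriv ψ g) (c : ℂ) : HasWeakDeriv (c • ψ) (c • g) := by
  intro η h1 h2
  have e1 : ∫ s, deriv η s • (c • ψ) s = ∫ s, c • (deriv η s • ψ s) :=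
    integral_congr_ae (by
      filter_upwards [Lp.coeFn_smul c ψ] with s hs
      rw [hs, Pi.smul_apply, smul_comm])
  have e2 : ∫ s, η s • (c • g) s = ∫ s, c • (η s • g s) :=
    integral_congr_ae (by
      filter_upwards [Lp.coeFn_smul c g] with s hs
      rw [hs, Pi.smul_apply, smul_comm])
  rw [e1, e2, integral_smul, integral_smul, h η h1 h2, smul_neg]

/-- An `H¹` function on the line is bounded. -/
theorem exists_norm_le (h : HasWeakDeriv ψ g) : ∃ M, 0 ≤ M ∧ ∀ᵐ s, ‖ψ s‖ ≤ M := by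
  obtain ⟨U, hU, hψ⟩ := h.exists_isPrimitive
  set c : ℝ := ∫ t, ‖g t‖ ^ 2
  set q : ℝ := ∫ t, ‖ψ t‖ ^ 2
  have hc : 0 ≤ c := integral_nonneg fun _ => by positivity
  have hq : 0 ≤ q := integral_nonneg fun _ => by positivity
  have hUi : Integrable fun t => ‖U t‖ ^ 2 := (integrable_norm_sq ψ).congr (by
    filter_upwards [hψ] with s hs; rw [hs])
  have hUq : ∫ t, ‖U t‖ ^ 2 = q := integral_congr_ae (by
    filter_upwards [hψ] with s hs; rw [hs])
  -- From ‖g‖ ≤ 1 + ‖g‖², the variation of U over a unit interval is at most 1 + c.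
  have key : ∀ x y, x ≤ y → y ≤ x + 1 → ‖U x‖ ≤ ‖U y‖ + (1 + c) := by
    intro x y hxy hyx
    have h1 := hU.dist_le hxy
    have hi := intervalIntegrable_of_loc (locallyIntegrable_norm hU.loc) x y
    have h2 : ∫ t in x..y, ‖g t‖ ≤ ∫ t in x..y, (1 + ‖g t‖ ^ 2) :=
      intervalIntegral.integral_mono_on hxy hi
        (intervalIntegrable_const.add (integrable_norm_sq g).intervalIntegrable)
        fun t _ => by nlinarith [sq_nonneg (‖g t‖ - 1), sq_nonneg ‖g t‖]
    rw [intervalIntegral.integral_add intervalIntegrable_const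
      (integrable_norm_sq g).intervalIntegrable, intervalIntegral.integral_const,
      intervalIntegral.integral_of_le hxy, intervalIntegral.integral_of_le hxy] at h2
    have h3 : ∫ t in Ioc x y, ‖g t‖ ^ 2 ≤ c :=
      setIntegral_le_integral (integrable_norm_sq g) (ae_of_all _ fun _ => by positivity)
    rw [intervalIntegral.integral_of_le hxy, dist_eq_norm] at h1
    have h4 := norm_le_norm_add_norm_sub' (U x) (U y)
    simp only [smul_eq_mul, mul_one] at h2
    linarith
  -- Otherwise ‖U‖ ≥ q + 1 on a whole unit interval, which alone contributes (q + 1)² > q to the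
  -- integral of ‖U‖².
  have bound : ∀ x, ‖U x‖ ≤ 1 + c + (q + 1) := by
    intro x
    by_contra! hx
    have h1 : ∫ y in Ioc x (x + 1), (q + 1) ^ 2 ≤ ∫ y in Ioc x (x + 1), ‖U y‖ ^ 2 := by
      refine setIntegral_mono_on (integrableOn_const (by simp)) hUi.integrableOn measurableSet_Ioc
        fun y hy => ?_
      have := key x y hy.1.le hy.2
      exact pow_le_pow_left₀ (by positivity) (by linarith) 2
    have h2 : ∫ y in Ioc x (x + 1), ‖U y‖ ^ 2 ≤ q := hUq ▸
      setIntegral_le_integral hUi (ae_of_all _ fun _ => by positivity)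
    simp at h1
    nlinarith
  exact ⟨1 + c + (q + 1), by positivity, by filter_upwards [hψ] with s hs; rw [hs]; exact bound s⟩

end HasWeakDeriv

theorem hasWeakDeriv_weakDeriv {ψ : L2} (h : ψ ∈ H1) : HasWeakDeriv ψ (weakDeriv ψ) := by
  obtain ⟨g, hg⟩ := h
  rwa [hg.weakDeriv_eq]

theorem integrable_weight {ψ : L2} (h : ψ ∈ X) : Integrable fun s : ℝ => s ^ 2 * ‖ψ s‖ ^ 2 := by
  refine (h.2.sub (integrable_norm_sq (weakDeriv ψ))).congr (ae_of_all _ fun s => ?_)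
  simp

theorem mem_X_of_hasWeakDeriv {ψ g : L2} (h : HasWeakDeriv ψ g)
    (hw : Integrable fun s : ℝ => s ^ 2 * ‖ψ s‖ ^ 2) : ψ ∈ X :=
  ⟨⟨g, h⟩, (integrable_norm_sq (weakDeriv ψ)).add hw⟩

theorem smul_mem_X {ψ : L2} (h : ψ ∈ X) (c : ℂ) : c • ψ ∈ X := by
  refine mem_X_of_hasWeakDeriv ((hasWeakDeriv_weakDeriv h.1).smul c) ?_
  refine ((integrable_weight h).const_mul (‖c‖ ^ 2)).congr ?_
  filter_upwards [Lp.coeFn_smul c ψ] with s hs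
  rw [hs, Pi.smul_apply, norm_smul]
  ring

theorem add_mem_X {ψ χ : L2} (h : ψ ∈ X) (h' : χ ∈ X) : ψ + χ ∈ X := by
  refine mem_X_of_hasWeakDeriv ((hasWeakDeriv_weakDeriv h.1).add (hasWeakDeriv_weakDeriv h'.1)) ?_
  refine (((integrable_weight h).add (integrable_weight h')).const_mul 2).mono
    (((continuous_pow 2).aestronglyMeasurable).mul
      ((Lp.aestronglyMeasurable (ψ + χ)).norm.fun_pow 2)) ?_
  filter_upwards [Lp.coeFn_add ψ χ] with s hs
  rw [hs, Pi.add_apply, Pi.add_apply, Real.norm_of_nonneg (by positivity),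
    Real.norm_of_nonneg (by positivity), ← mul_add, mul_left_comm]
  refine mul_le_mul_of_nonneg_left ?_ (by positivity)
  have := norm_add_le (ψ s) (χ s)
  nlinarith [sq_nonneg (‖ψ s‖ - ‖χ s‖), norm_nonneg (ψ s + χ s)]

theorem weakDeriv_smul {ψ : L2} (h : ψ ∈ H1) (c : ℂ) : weakDeriv (c • ψ) = c • weakDeriv ψ :=
  ((hasWeakDeriv_weakDeriv h).smul c).weakDeriv_eq

theorem weakDeriv_add {ψ χ : L2} (h : ψ ∈ H1) (h' : χ ∈ H1) :
    weakDeriv (ψ + χ) = weakDeriv ψ + weakDeriv χ :=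
  ((hasWeakDeriv_weakDeriv h).add (hasWeakDeriv_weakDeriv h')).weakDeriv_eq

/-- Construction of elements of `X` from concrete functions. -/
theorem exists_mem_X_of_isPrimitive {U v : ℝ → ℂ} (h : IsPrimitive U v)
    (hU : Integrable fun s => ‖U s‖ ^ 2) (hv : Integrable fun s => ‖v s‖ ^ 2)
    (hw : Integrable fun s : ℝ => s ^ 2 * ‖U s‖ ^ 2) :
    ∃ ψ ∈ X, ψ =ᵐ[volume] U ∧ weakDeriv ψ =ᵐ[volume] v := by
  have m1 : MemLp U 2 := (memLp_two_iff_integrable_sq_norm h.continuous.aestronglyMeasurable).2 hU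
  have m2 : MemLp v 2 := (memLp_two_iff_integrable_sq_norm h.loc.aestronglyMeasurable).2 hv
  have hd : HasWeakDeriv (m1.toLp U) (m2.toLp v) :=
    .of_isPrimitive h m1.coeFn_toLp m2.coeFn_toLp
  refine ⟨m1.toLp U, mem_X_of_hasWeakDeriv hd (hw.congr ?_), m1.coeFn_toLp, ?_⟩
  · filter_upwards [m1.coeFn_toLp] with s hs
    rw [hs]
  · rw [hd.weakDeriv_eq]
    exact m2.coeFn_toLp

/-! ### The energy density, and quadratic means in the energy space. -/

/-- The nonlinear energy density `√(1 + 2λρ) ρ` as a function of the density `ρ`. -/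
def nonlin (lam ρ : ℝ) : ℝ := √(1 + 2 * lam * ρ) * ρ

/-- The total energy density. -/
def energyDensity (C lam : ℝ) (ψ : L2) (s : ℝ) : ℝ :=
  ‖weakDeriv ψ s‖ ^ 2 + s ^ 2 * ‖ψ s‖ ^ 2 + C * nonlin lam (‖ψ s‖ ^ 2)

theorem nonlin_nonneg {lam ρ : ℝ} (h : 0 ≤ ρ) : 0 ≤ nonlin lam ρ :=
  mul_nonneg (Real.sqrt_nonneg _) h

theorem continuous_nonlin (lam : ℝ) : Continuous (nonlin lam) := by
  unfold nonlin
  fun_prop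

theorem integrable_nonlin {ψ : L2} {lam : ℝ} (hlam : 0 ≤ lam) (h : ψ ∈ H1) :
    Integrable fun s => nonlin lam (‖ψ s‖ ^ 2) := by
  obtain ⟨M, hM0, hM⟩ := (hasWeakDeriv_weakDeriv h).exists_norm_le
  refine ((integrable_norm_sq ψ).const_mul √(1 + 2 * lam * M ^ 2)).mono
    ((continuous_nonlin lam).comp_aestronglyMeasurable
      ((Lp.aestronglyMeasurable ψ).norm.fun_pow 2)) ?_
  filter_upwards [hM] with s hs
  rw [Real.norm_of_nonneg (nonlin_nonneg (by positivity)), Real.norm_of_nonneg (by positivity),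
    nonlin]
  gcongr

theorem integrable_energyDensity {ψ : L2} (C : ℝ) {lam : ℝ} (hlam : 0 ≤ lam) (h : ψ ∈ X) :
    Integrable (energyDensity C lam ψ) :=
  ((integrable_norm_sq _).add (integrable_weight h)).add ((integrable_nonlin hlam h.1).const_mul C)

theorem energy_eq_integral {ψ : L2} (C : ℝ) {lam : ℝ} (hlam : 0 ≤ lam) (h : ψ ∈ X) :
    energy C lam ψ = ∫ s, energyDensity C lam ψ s := by
  have e1 := integral_add ((integrable_norm_sq (weakDeriv ψ)).add (integrable_weight h))
    ((integrable_nonlin hlam h.1).const_mul C)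
  have e2 := integral_add (integrable_norm_sq (weakDeriv ψ)) (integrable_weight h)
  simp only [Pi.add_apply] at e1
  unfold energyDensity
  rw [e1, e2, integral_const_mul]
  rfl

theorem energyDensity_nonneg {C : ℝ} (hC : 0 ≤ C) (lam : ℝ) (ψ : L2) (s : ℝ) :
    0 ≤ energyDensity C lam ψ s := by
  have := nonlin_nonneg (lam := lam) (sq_nonneg ‖ψ s‖)
  unfold energyDensity
  positivity

/-- The quadratic mean `√((|ψ|² + |χ|²) / 2)` of two elements of the energy space. -/
theorem exists_quadraticMean {ψ χ : L2} (h : ψ ∈ X) (h' : χ ∈ X) :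
    ∃ m ∈ X, (∀ᵐ s, m s = (√((‖ψ s‖ ^ 2 + ‖χ s‖ ^ 2) / 2) : ℂ)) ∧
      ∃ w : ℝ → ℝ, (∀ᵐ s, weakDeriv m s = (w s : ℂ)) ∧
      ∀ᵐ s, 2 * (√((‖ψ s‖ ^ 2 + ‖χ s‖ ^ 2) / 2) * w s) =
          (weakDeriv ψ s * starRingEnd ℂ (ψ s)).re + (weakDeriv χ s * starRingEnd ℂ (χ s)).re ∧
        (ψ s = 0 → χ s = 0 → w s = 0) := by
  obtain ⟨U, hU, hψ⟩ := (hasWeakDeriv_weakDeriv h.1).exists_isPrimitive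
  obtain ⟨V, hV, hχ⟩ := (hasWeakDeriv_weakDeriv h'.1).exists_isPrimitive
  obtain ⟨w, hw, hw'⟩ := hU.exists_quadraticMean hV
  have hsq : ∀ s, ‖(√((‖U s‖ ^ 2 + ‖V s‖ ^ 2) / 2) : ℂ)‖ ^ 2 = (‖U s‖ ^ 2 + ‖V s‖ ^ 2) / 2 := by
    intro s
    rw [Complex.norm_real, Real.norm_of_nonneg (Real.sqrt_nonneg _), Real.sq_sqrt (by positivity)]
  obtain ⟨m, hm, h1, h2⟩ := exists_mem_X_of_isPrimitive hw
    (by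
      simp only [hsq]
      refine (((integrable_norm_sq ψ).add (integrable_norm_sq χ)).div_const 2).congr ?_
      filter_upwards [hψ, hχ] with s e1 e2
      simp only [Pi.add_apply, e1, e2])
    (by
      refine (((integrable_norm_sq (weakDeriv ψ)).add
        (integrable_norm_sq (weakDeriv χ))).div_const 2).mono
          (hw.loc.aestronglyMeasurable.norm.fun_pow 2) ?_
      filter_upwards [hw'] with s hs
      rw [Complex.norm_real, Real.norm_of_nonneg (sq_nonneg _), Real.norm_eq_abs, sq_abs]
      refine le_trans ?_ (le_abs_self _)
      exact sq_le_of_two_mul_eq_re_add_re (Real.sq_sqrt (by positivity)) hs.1 hs.2)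
    (by
      simp only [hsq]
      refine (((integrable_weight h).add (integrable_weight h')).div_const 2).congr ?_
      filter_upwards [hψ, hχ] with s e1 e2
      simp only [Pi.add_apply, e1, e2]
      ring)
  refine ⟨m, hm, ?_, w, h2, ?_⟩
  · filter_upwards [h1, hψ, hχ] with s e e1 e2
    rw [e, e1, e2]
  · filter_upwards [hw', hψ, hχ] with s e e1 e2
    rw [e1, e2]
    exact e

/-! ### Quantitative convexity of the nonlinearity. -/

/-- The derivative of `nonlin`. -/
def nonlinDeriv (lam ρ : ℝ) : ℝ := (1 + 3 * lam * ρ) / √(1 + 2 * lam * ρ)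

section nonlin

variable {lam ρ σ : ℝ}

theorem one_le_sqrt_amplitude (hlam : 0 < lam) (hρ : 0 ≤ ρ) : 1 ≤ √(1 + 2 * lam * ρ) := by
  rw [Real.one_le_sqrt]
  have := mul_nonneg hlam.le hρ
  linarith

/-- In the variable a = √(1 + 2λρ) one has ρ = (a² - 1)/(2λ) and the nonlinearity becomes the cubic
a(a² - 1)/(2λ); the tangent remainder then contains the factor (b - a)² explicitly. -/
theorem nonlin_sub_tangent (hlam : 0 < lam) (hρ : 0 ≤ ρ) (hσ : 0 ≤ σ) :
    nonlin lam σ - nonlin lam ρ - nonlinDeriv lam ρ * (σ - ρ) =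
      (√(1 + 2 * lam * σ) - √(1 + 2 * lam * ρ)) ^ 2 / (2 * lam) *
        (√(1 + 2 * lam * σ) + √(1 + 2 * lam * ρ) / 2 + 1 / (2 * √(1 + 2 * lam * ρ))) := by
  have ha := one_le_sqrt_amplitude hlam hρ
  have ha2 : √(1 + 2 * lam * ρ) ^ 2 = 1 + 2 * lam * ρ := Real.sq_sqrt (by positivity)
  have hb2 : √(1 + 2 * lam * σ) ^ 2 = 1 + 2 * lam * σ := Real.sq_sqrt (by positivity)
  unfold nonlin nonlinDeriv
  generalize √(1 + 2 * lam * ρ) = a at *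
  generalize √(1 + 2 * lam * σ) = b at *
  have e1 : ρ = (a ^ 2 - 1) / (2 * lam) := by field_simp; linarith
  have e2 : σ = (b ^ 2 - 1) / (2 * lam) := by field_simp; linarith
  have : a ≠ 0 := by positivity
  rw [e1, e2]
  field_simp
  ring

/-- As a, b ≥ 1, the last factor of the exact remainder is at most (a + b)²/2, and (b - a)(b + a) =
2λ(σ - ρ). This controls the second order term in the first variation. -/
theorem nonlin_le_tangent_add (hlam : 0 < lam) (hρ : 0 ≤ ρ) (hσ : 0 ≤ σ) :
    nonlin lam σ ≤ nonlin lam ρ + nonlinDeriv lam ρ * (σ - ρ) + lam * (σ - ρ) ^ 2 := by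
  have h := nonlin_sub_tangent hlam hρ hσ
  have ha := one_le_sqrt_amplitude hlam hρ
  have hb := one_le_sqrt_amplitude hlam hσ
  have ha2 : √(1 + 2 * lam * ρ) ^ 2 = 1 + 2 * lam * ρ := Real.sq_sqrt (by positivity)
  have hb2 : √(1 + 2 * lam * σ) ^ 2 = 1 + 2 * lam * σ := Real.sq_sqrt (by positivity)
  set a := √(1 + 2 * lam * ρ)
  set b := √(1 + 2 * lam * σ)
  have e : lam * (σ - ρ) ^ 2 = (b - a) ^ 2 / (2 * lam) * ((b + a) ^ 2 / 2) := by
    have : σ - ρ = (b - a) * (b + a) / (2 * lam) := by field_simp; linarith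
    rw [this]
    field_simp
  have h1 : 1 / (2 * a) ≤ 1 / 2 := by
    rw [div_le_div_iff₀ (by positivity) (by norm_num)]
    linarith
  have h2 : b + a / 2 + 1 / (2 * a) ≤ (b + a) ^ 2 / 2 := by nlinarith
  have := mul_le_mul_of_nonneg_left h2 (by positivity : 0 ≤ (b - a) ^ 2 / (2 * lam))
  linarith

/-- The last factor of the exact remainder is at least b ≥ 1. -/
theorem tangent_add_le_nonlin (hlam : 0 < lam) (hρ : 0 ≤ ρ) (hσ : 0 ≤ σ) :
    nonlin lam ρ + nonlinDeriv lam ρ * (σ - ρ) +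
      (√(1 + 2 * lam * σ) - √(1 + 2 * lam * ρ)) ^ 2 / (2 * lam) ≤ nonlin lam σ := by
  have h := nonlin_sub_tangent hlam hρ hσ
  have ha := one_le_sqrt_amplitude hlam hρ
  have hb := one_le_sqrt_amplitude hlam hσ
  set a := √(1 + 2 * lam * ρ)
  set b := √(1 + 2 * lam * σ)
  have h2 : 1 ≤ b + a / 2 + 1 / (2 * a) := by
    have : 0 ≤ 1 / (2 * a) := by positivity
    linarith
  have := mul_le_mul_of_nonneg_left h2 (by positivity : 0 ≤ (b - a) ^ 2 / (2 * lam))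
  linarith

/-- Quantitative strict midpoint convexity of `nonlin`. -/
theorem nonlin_midpoint_add_le (hlam : 0 < lam) (hρ : 0 ≤ ρ) (hσ : 0 ≤ σ) :
    nonlin lam ((ρ + σ) / 2) + (√(1 + 2 * lam * ρ) - √(1 + 2 * lam * σ)) ^ 2 / (8 * lam) ≤
      (nonlin lam ρ + nonlin lam σ) / 2 := by
  have hm : 0 ≤ (ρ + σ) / 2 := by positivity
  -- Both tangents are taken at the midpoint, so their linear terms cancel in the average.
  have h1 := tangent_add_le_nonlin hlam hm hρ
  have h2 := tangent_add_le_nonlin hlam hm hσ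
  set a := √(1 + 2 * lam * ρ)
  set b := √(1 + 2 * lam * σ)
  set c := √(1 + 2 * lam * ((ρ + σ) / 2))
  have h3 : (a - b) ^ 2 / (8 * lam) ≤ ((a - c) ^ 2 / (2 * lam) + (b - c) ^ 2 / (2 * lam)) / 2 := by
    rw [← add_div, div_div, div_le_div_iff₀ (by positivity) (by positivity)]
    have : (a - b) ^ 2 ≤ 2 * ((a - c) ^ 2 + (b - c) ^ 2) := by
      nlinarith [sq_nonneg (a - c + (b - c))]
    nlinarith
  linarith

theorem nonlin_mono (hlam : 0 ≤ lam) (hρ : 0 ≤ ρ) (h : ρ ≤ σ) : nonlin lam ρ ≤ nonlin lam σ := by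
  unfold nonlin
  gcongr

/-- For t ≥ 1 the square root grows at most by the factor t. This bounds the cost of scaling a
function of charge below 1 up to charge 1. -/
theorem nonlin_mul_le (hlam : 0 < lam) (hρ : 0 ≤ ρ) {t : ℝ} (ht : 1 ≤ t) :
    nonlin lam (t * ρ) ≤ t ^ 2 * nonlin lam ρ := by
  have : √(1 + 2 * lam * (t * ρ)) ≤ t * √(1 + 2 * lam * ρ) := by
    refine Real.sqrt_le_iff.2 ⟨by positivity, ?_⟩
    rw [mul_pow, Real.sq_sqrt (by positivity)]
    have := mul_nonneg hlam.le hρ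
    nlinarith [mul_nonneg this (by linarith : 0 ≤ t - 1)]
  unfold nonlin
  calc _ ≤ t * √(1 + 2 * lam * ρ) * (t * ρ) := by gcongr
    _ = _ := by ring

theorem nonlin_midpoint_le (hlam : 0 < lam) (z w : ℂ) :
    nonlin lam (‖(2⁻¹ : ℂ) * (z + w)‖ ^ 2) ≤
      (nonlin lam (‖z‖ ^ 2) + nonlin lam (‖w‖ ^ 2)) / 2 := by
  have h := nonlin_midpoint_add_le hlam (sq_nonneg ‖z‖) (sq_nonneg ‖w‖)
  have h1 : ‖(2⁻¹ : ℂ) * (z + w)‖ ^ 2 ≤ (‖z‖ ^ 2 + ‖w‖ ^ 2) / 2 := by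
    have := norm_add_le z w
    rw [norm_mul, norm_inv, Complex.norm_two]
    nlinarith [sq_nonneg (‖z‖ - ‖w‖), norm_nonneg (z + w)]
  have h2 : 0 ≤ (√(1 + 2 * lam * ‖z‖ ^ 2) - √(1 + 2 * lam * ‖w‖ ^ 2)) ^ 2 / (8 * lam) := by
    positivity
  linarith [nonlin_mono hlam.le (sq_nonneg _) h1]

end nonlin

/-! ### The constrained minimum and convexity along quadratic means. -/

section minimisation

variable {C lam : ℝ}

theorem energy_nonneg (hC : 0 ≤ C) {ψ : L2} (hlam : 0 ≤ lam) (h : ψ ∈ X) : 0 ≤ energy C lam ψ := by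
  rw [energy_eq_integral C hlam h]
  exact integral_nonneg fun s => energyDensity_nonneg hC lam ψ s

theorem minEnergy_le (hC : 0 ≤ C) (hlam : 0 ≤ lam) {ψ : L2} (h : ψ ∈ Sigma1) :
    minEnergy C lam ≤ energy C lam ψ :=
  csInf_le ⟨0, by rintro _ ⟨χ, hχ, rfl⟩; exact energy_nonneg hC hlam hχ.1⟩ ⟨ψ, h, rfl⟩

theorem charge_smul (c : ℂ) (ψ : L2) : charge (c • ψ) = ‖c‖ ^ 2 * charge ψ := by
  rw [charge_eq_norm_sq, charge_eq_norm_sq, norm_smul, mul_pow]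

theorem norm_eq_one_of_mem_Sigma1 {ψ : L2} (h : ψ ∈ Sigma1) : ‖ψ‖ = 1 := by
  have := h.2
  rw [charge_eq_norm_sq] at this
  nlinarith [norm_nonneg ψ]

theorem normalize_mem_Sigma1 {ψ : L2} (h : ψ ∈ X) (h0 : ψ ≠ 0) :
    ((‖ψ‖⁻¹ : ℝ) : ℂ) • ψ ∈ Sigma1 := by
  refine ⟨smul_mem_X h _, ?_⟩
  rw [charge_eq_norm_sq, norm_smul, Complex.norm_real, norm_inv, norm_norm,
    inv_mul_cancel₀ (norm_ne_zero_iff.2 h0), one_pow]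

theorem isPrimitive_of_hasDerivAt {U v : ℝ → ℂ} (h : ∀ x, HasDerivAt U (v x) x)
    (hv : Continuous v) : IsPrimitive U v := by
  have hd : deriv U = v := funext fun x => (h x).deriv
  have : ContDiff ℝ 1 U := contDiff_one_iff_deriv.2 ⟨fun x => (h x).differentiableAt, hd ▸ hv⟩
  exact ⟨fun a b => this.contDiffOn.absolutelyContinuousOnInterval, hv.locallyIntegrable,
    ae_of_all _ h⟩

/-- A normalised bump. Over an empty constraint set the real infimum would be the default value 0,
and no minimising sequence would exist. -/
theorem Sigma1_nonempty : Sigma1.Nonempty := by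
  obtain ⟨b, hb, hc, hb0⟩ : ∃ b : ℝ → ℝ, ContDiff ℝ ∞ b ∧ HasCompactSupport b ∧ b 0 = 1 := by
    let b : ContDiffBump (0 : ℝ) := ⟨1, 2, one_pos, one_lt_two⟩
    exact ⟨b, b.contDiff, b.hasCompactSupport, b.one_of_mem_closedBall (by simp [b])⟩
  have hd := continuous_deriv_of_contDiff hb
  have hdiff : Differentiable ℝ b := hb.differentiable (by simp)
  have hP : IsPrimitive (fun s => (b s : ℂ)) (fun s => ((deriv b s : ℝ) : ℂ)) :=
    isPrimitive_of_hasDerivAt (fun x => (hdiff x).hasDerivAt.ofReal_comp)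
      (Complex.continuous_ofReal.comp hd)
  have sq : ∀ {η : ℝ → ℝ}, HasCompactSupport η → HasCompactSupport fun s => ‖(η s : ℂ)‖ ^ 2 :=
    fun h => h.comp_left (g := fun x : ℝ => ‖(x : ℂ)‖ ^ 2) (by simp)
  obtain ⟨ψ, hψ, h1, -⟩ := exists_mem_X_of_isPrimitive hP
    (Continuous.integrable_of_hasCompactSupport (by have := hb.continuous; fun_prop) (sq hc))
    (Continuous.integrable_of_hasCompactSupport (by fun_prop) (sq hc.deriv))
    (Continuous.integrable_of_hasCompactSupport (by have := hb.continuous; fun_prop) (sq hc).mul_left)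
  refine ⟨_, normalize_mem_Sigma1 hψ ?_⟩
  rintro rfl
  have : (fun s => (b s : ℂ)) =ᵐ[volume] fun _ => 0 := h1.symm.trans (Lp.coeFn_zero _ _ _)
  have := congrFun ((Continuous.ae_eq_iff_eq volume hP.continuous continuous_const).1 this) 0
  simp only [Complex.ofReal_eq_zero] at this
  rw [hb0] at this
  exact one_ne_zero this

theorem exists_energy_lt {ε : ℝ} (hε : 0 < ε) :
    ∃ ψ ∈ Sigma1, energy C lam ψ < minEnergy C lam + ε := by
  obtain ⟨_, ⟨ψ, hψ, rfl⟩, h⟩ := exists_lt_of_csInf_lt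
    (Sigma1_nonempty.image (energy C lam)) (lt_add_of_pos_right (minEnergy C lam) hε)
  exact ⟨ψ, hψ, h⟩

theorem norm_ofReal_sqrt_sq {x : ℝ} (hx : 0 ≤ x) : ‖(√x : ℂ)‖ ^ 2 = x := by
  rw [Complex.norm_real, Real.norm_of_nonneg (Real.sqrt_nonneg _), Real.sq_sqrt hx]

/-- The product of the two roots is at least 1, so the cross term absorbs the constants 1 + 1, which
would not be integrable over the line. -/
theorem sq_sub_amplitude_le (hlam : 0 < lam) {ρ σ : ℝ} (hρ : 0 ≤ ρ) (hσ : 0 ≤ σ) :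
    (√(1 + 2 * lam * ρ) - √(1 + 2 * lam * σ)) ^ 2 ≤ 2 * lam * (ρ + σ) := by
  have ha := one_le_sqrt_amplitude hlam hρ
  have hb := one_le_sqrt_amplitude hlam hσ
  have ha2 : √(1 + 2 * lam * ρ) ^ 2 = 1 + 2 * lam * ρ := Real.sq_sqrt (by positivity)
  have hb2 : √(1 + 2 * lam * σ) ^ 2 = 1 + 2 * lam * σ := Real.sq_sqrt (by positivity)
  nlinarith

theorem aestronglyMeasurable_amplitude (lam : ℝ) (ψ : L2) :
    AEStronglyMeasurable (fun s => √(1 + 2 * lam * ‖ψ s‖ ^ 2)) :=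
  (by fun_prop : Continuous fun r : ℝ => √(1 + 2 * lam * r ^ 2)).comp_aestronglyMeasurable
    (Lp.aestronglyMeasurable ψ).norm

theorem integrable_sq_sub_amplitude (hlam : 0 < lam) (ψ χ : L2) :
    Integrable fun s => (√(1 + 2 * lam * ‖ψ s‖ ^ 2) - √(1 + 2 * lam * ‖χ s‖ ^ 2)) ^ 2 := by
  refine (((integrable_norm_sq ψ).add (integrable_norm_sq χ)).const_mul (2 * lam)).mono
    (((aestronglyMeasurable_amplitude lam ψ).sub
      (aestronglyMeasurable_amplitude lam χ)).fun_pow 2) (ae_of_all _ fun s => ?_)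
  rw [Real.norm_of_nonneg (sq_nonneg _)]
  exact (sq_sub_amplitude_le hlam (sq_nonneg _) (sq_nonneg _)).trans (le_abs_self _)

/-- The energy is strictly convex along quadratic means. -/
theorem exists_quadraticMean_energy_add_le (hC : 0 ≤ C) (hlam : 0 < lam) {ψ χ : L2}
    (h : ψ ∈ Sigma1) (h' : χ ∈ Sigma1) :
    ∃ m ∈ Sigma1, (∀ᵐ s, m s = (√((‖ψ s‖ ^ 2 + ‖χ s‖ ^ 2) / 2) : ℂ)) ∧
      energy C lam m + C / (8 * lam) *
        ∫ s, (√(1 + 2 * lam * ‖ψ s‖ ^ 2) - √(1 + 2 * lam * ‖χ s‖ ^ 2)) ^ 2 ≤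
        (energy C lam ψ + energy C lam χ) / 2 := by
  obtain ⟨m, hm, hm1, w, hw, hw'⟩ := exists_quadraticMean h.1 h'.1
  refine ⟨m, ⟨hm, ?_⟩, hm1, ?_⟩
  · have : charge m = ∫ s, (‖ψ s‖ ^ 2 + ‖χ s‖ ^ 2) / 2 := integral_congr_ae (by
      filter_upwards [hm1] with s hs
      rw [hs, norm_ofReal_sqrt_sq (by positivity)])
    rw [this, integral_div, integral_add (integrable_norm_sq _) (integrable_norm_sq _)]
    have e1 := h.2
    have e2 := h'.2
    unfold charge at e1 e2
    rw [e1, e2]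
    norm_num
  · rw [energy_eq_integral C hlam.le hm, energy_eq_integral C hlam.le h.1,
      energy_eq_integral C hlam.le h'.1, ← integral_const_mul,
      ← integral_add (integrable_energyDensity C hlam.le hm)
        ((integrable_sq_sub_amplitude hlam ψ χ).const_mul _),
      ← integral_add (integrable_energyDensity C hlam.le h.1)
        (integrable_energyDensity C hlam.le h'.1), ← integral_div]
    refine integral_mono_ae ((integrable_energyDensity C hlam.le hm).add
      ((integrable_sq_sub_amplitude hlam ψ χ).const_mul _))
      (((integrable_energyDensity C hlam.le h.1).add
        (integrable_energyDensity C hlam.le h'.1)).div_const 2) ?_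
    filter_upwards [hm1, hw, hw'] with s e1 e2 e3
    have i1 : ‖weakDeriv m s‖ ^ 2 ≤ (‖weakDeriv ψ s‖ ^ 2 + ‖weakDeriv χ s‖ ^ 2) / 2 := by
      rw [e2, Complex.norm_real, Real.norm_eq_abs, sq_abs]
      exact sq_le_of_two_mul_eq_re_add_re (Real.sq_sqrt (by positivity)) e3.1 e3.2
    have i2 := mul_le_mul_of_nonneg_left
      (nonlin_midpoint_add_le hlam (sq_nonneg ‖ψ s‖) (sq_nonneg ‖χ s‖)) hC
    simp only [energyDensity]
    rw [e1, norm_ofReal_sqrt_sq (by positivity)]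
    rw [mul_add, mul_div_assoc', ← div_mul_eq_mul_div] at i2
    linarith

end minimisation

/-! ### Stability: almost minimisers are close to each other. -/

variable {C lam : ℝ}

/-- `ψ` is real-valued and nonnegative almost everywhere. -/
def IsNonneg (ψ : L2) : Prop := ∀ᵐ s, ψ s = (‖ψ s‖ : ℂ)

theorem isNonneg_of_ae_eq {ψ : L2} {r : ℝ → ℝ} (hr : ∀ s, 0 ≤ r s) (h : ∀ᵐ s, ψ s = (r s : ℂ)) :
    IsNonneg ψ := by
  filter_upwards [h] with s hs
  rw [hs, Complex.norm_real, Real.norm_of_nonneg (hr s)]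

/-- The quadratic mean of ψ with itself is |ψ|, so passing to the modulus does not raise the energy.
-/
theorem exists_isNonneg_energy_lt (hC : 0 < C) (hlam : 0 < lam) {ε : ℝ} (hε : 0 < ε) :
    ∃ ψ ∈ Sigma1, IsNonneg ψ ∧ energy C lam ψ < minEnergy C lam + ε := by
  obtain ⟨ψ, hψ, h⟩ := exists_energy_lt (C := C) (lam := lam) hε
  obtain ⟨m, hm, hm1, hm2⟩ := exists_quadraticMean_energy_add_le hC.le hlam hψ hψ
  refine ⟨m, hm, isNonneg_of_ae_eq (fun s => Real.sqrt_nonneg _) hm1, ?_⟩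
  simp only [sub_self, ne_eq, OfNat.ofNat_ne_zero, not_false_eq_true, zero_pow, integral_zero,
    mul_zero, add_zero] at hm2
  linarith

theorem integral_weight_le_energy (hC : 0 ≤ C) (lam : ℝ) (ψ : L2) :
    ∫ s : ℝ, s ^ 2 * ‖ψ s‖ ^ 2 ≤ energy C lam ψ := by
  have h1 : 0 ≤ ∫ s, ‖weakDeriv ψ s‖ ^ 2 := integral_nonneg fun s => sq_nonneg _
  have h2 : 0 ≤ C * ∫ s, √(1 + 2 * lam * ‖ψ s‖ ^ 2) * ‖ψ s‖ ^ 2 :=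
    mul_nonneg hC (integral_nonneg fun s => by positivity)
  unfold energy
  linarith

/-- With a, b the two roots, (u - v)² ≤ |u² - v²| = |a - b|(a + b)/(2λ). Inside [-R, R] Young's
inequality with parameter K splits the product, and 2(a² + b²) = 4 + 4λ(u² + v²) explains the
constant 4. Outside, where that constant is not integrable, s² ≥ R² lets the weight bound u² + v².
-/
theorem norm_sub_sq_le_pointwise (hlam : 0 < lam) {R K : ℝ} (hR : 0 < R) (hK : 0 < K) {u v s : ℝ}
    (hu : 0 ≤ u) (hv : 0 ≤ v) :
    (u - v) ^ 2 ≤ K / (4 * lam) * (√(1 + 2 * lam * u ^ 2) - √(1 + 2 * lam * v ^ 2)) ^ 2 +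
      1 / (4 * lam * K) * ((Icc (-R) R).indicator (fun _ => 4) s + 4 * lam * (u ^ 2 + v ^ 2)) +
      1 / R ^ 2 * (s ^ 2 * u ^ 2 + s ^ 2 * v ^ 2) := by
  have h0 : (u - v) ^ 2 ≤ |u ^ 2 - v ^ 2| := by
    rw [show u ^ 2 - v ^ 2 = (u - v) * (u + v) by ring, abs_mul, ← sq_abs, sq,
      abs_of_nonneg (add_nonneg hu hv)]
    exact mul_le_mul_of_nonneg_left (abs_le.2 ⟨by linarith, by linarith⟩) (abs_nonneg _)
  refine h0.trans ?_
  have ha2 : √(1 + 2 * lam * u ^ 2) ^ 2 = 1 + 2 * lam * u ^ 2 := Real.sq_sqrt (by positivity)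
  have hb2 : √(1 + 2 * lam * v ^ 2) ^ 2 = 1 + 2 * lam * v ^ 2 := Real.sq_sqrt (by positivity)
  set a := √(1 + 2 * lam * u ^ 2)
  set b := √(1 + 2 * lam * v ^ 2)
  by_cases hs : s ∈ Icc (-R) R
  · rw [indicator_of_mem hs]
    have h1 : 4 + 4 * lam * (u ^ 2 + v ^ 2) = 2 * (a ^ 2 + b ^ 2) := by rw [ha2, hb2]; ring
    have h2 : |u ^ 2 - v ^ 2| = |a - b| * (a + b) / (2 * lam) := by
      have : u ^ 2 - v ^ 2 = (a - b) * (a + b) / (2 * lam) := by field_simp; linarith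
      rw [this, abs_div, abs_mul, abs_of_pos (by positivity : 0 < 2 * lam),
        abs_of_nonneg (by positivity : 0 ≤ a + b)]
    have h3 : 0 ≤ 1 / R ^ 2 * (s ^ 2 * u ^ 2 + s ^ 2 * v ^ 2) := by positivity
    have h4 : |a - b| * (a + b) / (2 * lam) ≤
        K / (4 * lam) * (a - b) ^ 2 + 1 / (4 * lam * K) * (2 * (a ^ 2 + b ^ 2)) := by
      have e : K / (4 * lam) * (a - b) ^ 2 + 1 / (4 * lam * K) * (2 * (a ^ 2 + b ^ 2)) =
          (K ^ 2 * (a - b) ^ 2 + 2 * (a ^ 2 + b ^ 2)) / (4 * lam * K) := by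
        field_simp
      rw [e, div_le_div_iff₀ (by positivity) (by positivity), ← sq_abs (a - b)]
      nlinarith [mul_nonneg hlam.le (sq_nonneg (K * |a - b| - (a + b))),
        mul_nonneg hlam.le (sq_nonneg (a - b))]
    rw [h1, h2]
    linarith
  · rw [indicator_of_notMem hs]
    have h1 : R ^ 2 ≤ s ^ 2 := by
      rw [mem_Icc, ← abs_le] at hs
      rw [← sq_abs s]
      exact pow_le_pow_left₀ hR.le (not_le.1 hs).le 2
    have h2 : |u ^ 2 - v ^ 2| ≤ u ^ 2 + v ^ 2 := by
      rw [abs_le]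
      constructor <;> nlinarith [sq_nonneg u, sq_nonneg v]
    have h3 : u ^ 2 + v ^ 2 ≤ 1 / R ^ 2 * (s ^ 2 * u ^ 2 + s ^ 2 * v ^ 2) := by
      rw [← mul_add, one_div_mul_eq_div, le_div_iff₀ (by positivity), mul_comm]
      exact mul_le_mul_of_nonneg_right h1 (by positivity)
    have h4 : 0 ≤ K / (4 * lam) * (a - b) ^ 2 := by positivity
    have h5 : 0 ≤ 1 / (4 * lam * K) * (0 + 4 * lam * (u ^ 2 + v ^ 2)) := by positivity
    linarith

/-- The quadratic mean has energy at least the minimum, so the convexity gap is at most δ; the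
pointwise bound is then integrated, with 8R = 4 · 2R from the indicator. -/
theorem norm_sub_sq_le (hC : 0 < C) (hlam : 0 < lam) {ψ χ : L2} (h : ψ ∈ Sigma1)
    (h' : χ ∈ Sigma1) (hn : IsNonneg ψ) (hn' : IsNonneg χ) {δ R K : ℝ} (hR : 0 < R) (hK : 0 < K)
    (hE : energy C lam ψ ≤ minEnergy C lam + δ) (hE' : energy C lam χ ≤ minEnergy C lam + δ) :
    ‖ψ - χ‖ ^ 2 ≤ K / (4 * lam) * (8 * lam / C * δ) + 1 / (4 * lam * K) * (8 * R + 8 * lam) +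
      1 / R ^ 2 * (2 * (minEnergy C lam + δ)) := by
  obtain ⟨m, hm, -, hm2⟩ := exists_quadraticMean_energy_add_le hC.le hlam h h'
  have hmin := minEnergy_le hC.le hlam.le hm
  set D := ∫ s, (√(1 + 2 * lam * ‖ψ s‖ ^ 2) - √(1 + 2 * lam * ‖χ s‖ ^ 2)) ^ 2
  have hD : D ≤ 8 * lam / C * δ := by
    have : C / (8 * lam) * D ≤ δ := by linarith
    calc D = 8 * lam / C * (C / (8 * lam) * D) := by field_simp
      _ ≤ _ := mul_le_mul_of_nonneg_left this (by positivity)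
  have iD := integrable_sq_sub_amplitude hlam ψ χ
  have iI : Integrable ((Icc (-R) R).indicator fun _ : ℝ => (4:ℝ)) :=
    (integrable_indicator_iff measurableSet_Icc).2 (integrableOn_const (by simp))
  have iQ := ((integrable_norm_sq ψ).add (integrable_norm_sq χ)).const_mul (4 * lam)
  have iW := (integrable_weight h.1).add (integrable_weight h'.1)
  have hI : ∫ s, (Icc (-R) R).indicator (fun _ : ℝ => (4:ℝ)) s = 8 * R := by
    rw [integral_indicator measurableSet_Icc, setIntegral_const]
    simp only [Measure.real, Real.volume_Icc, smul_eq_mul]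
    rw [ENNReal.toReal_ofReal (by linarith)]
    ring
  have hQ : ∫ s, 4 * lam * (‖ψ s‖ ^ 2 + ‖χ s‖ ^ 2) = 8 * lam := by
    rw [integral_const_mul, integral_add (integrable_norm_sq _) (integrable_norm_sq _)]
    have e1 := h.2
    have e2 := h'.2
    unfold charge at e1 e2
    rw [e1, e2]
    ring
  have hW : ∫ s : ℝ, (s ^ 2 * ‖ψ s‖ ^ 2 + s ^ 2 * ‖χ s‖ ^ 2) ≤ 2 * (minEnergy C lam + δ) := by
    rw [integral_add (integrable_weight h.1) (integrable_weight h'.1)]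
    linarith [integral_weight_le_energy hC.le lam ψ, integral_weight_le_energy hC.le lam χ]
  have key : ∫ s, ‖(ψ - χ) s‖ ^ 2 ≤ ∫ s, (K / (4 * lam) * (√(1 + 2 * lam * ‖ψ s‖ ^ 2) -
      √(1 + 2 * lam * ‖χ s‖ ^ 2)) ^ 2 + 1 / (4 * lam * K) * ((Icc (-R) R).indicator (fun _ => 4) s +
        4 * lam * (‖ψ s‖ ^ 2 + ‖χ s‖ ^ 2)) +
      1 / R ^ 2 * (s ^ 2 * ‖ψ s‖ ^ 2 + s ^ 2 * ‖χ s‖ ^ 2)) := by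
    refine integral_mono_ae (integrable_norm_sq _)
      (((iD.const_mul _).add ((iI.add iQ).const_mul _)).add (iW.const_mul _)) ?_
    filter_upwards [hn, hn', Lp.coeFn_sub ψ χ] with s e1 e2 e3
    rw [e3, Pi.sub_apply]
    have : ‖ψ s - χ s‖ ^ 2 = (‖ψ s‖ - ‖χ s‖) ^ 2 := by
      conv_lhs => rw [e1, e2, ← Complex.ofReal_sub, Complex.norm_real, Real.norm_eq_abs, sq_abs]
    rw [this]
    exact norm_sub_sq_le_pointwise hlam hR hK (norm_nonneg _) (norm_nonneg _)
  have e1 := integral_add ((iD.const_mul (K / (4 * lam))).add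
    ((iI.add iQ).const_mul (1 / (4 * lam * K)))) (iW.const_mul (1 / R ^ 2))
  have e2 := integral_add (iD.const_mul (K / (4 * lam)))
    ((iI.add iQ).const_mul (1 / (4 * lam * K)))
  have e3 := integral_add iI iQ
  simp only [Pi.add_apply] at e1 e2 e3
  rw [e1, e2, integral_const_mul, integral_const_mul, integral_const_mul, e3, hI, hQ] at key
  rw [← charge_eq_norm_sq]
  refine key.trans ?_
  gcongr

/-- Almost minimisers are close to each other in `L²`. -/
theorem exists_norm_sub_sq_lt (hC : 0 < C) (hlam : 0 < lam) {ε : ℝ} (hε : 0 < ε) :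
    ∃ δ > 0, ∀ ψ ∈ Sigma1, ∀ χ ∈ Sigma1, IsNonneg ψ → IsNonneg χ →
      energy C lam ψ ≤ minEnergy C lam + δ → energy C lam χ ≤ minEnergy C lam + δ →
      ‖ψ - χ‖ ^ 2 < ε := by
  have hE : 0 ≤ minEnergy C lam := Real.sInf_nonneg (by
    rintro _ ⟨χ, hχ, rfl⟩; exact energy_nonneg hC.le hlam.le hχ.1)
  set M := 2 * (minEnergy C lam + 1)
  have hM : 0 < M := by positivity
  -- The order matters: R first, then K depending on R, then δ depending on K. Each choice makes its
  -- term equal to ε/4.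
  obtain ⟨R, hR, hR'⟩ : ∃ R : ℝ, 0 < R ∧ 1 / R ^ 2 * M < ε / 3 := by
    refine ⟨√(4 * M / ε), by positivity, ?_⟩
    rw [Real.sq_sqrt (by positivity)]
    field_simp
    norm_num
  obtain ⟨K, hK, hK'⟩ : ∃ K : ℝ, 0 < K ∧ 1 / (4 * lam * K) * (8 * R + 8 * lam) < ε / 3 := by
    refine ⟨4 * (8 * R + 8 * lam) / (4 * lam * ε), by positivity, ?_⟩
    field_simp
    norm_num
  obtain ⟨δ, hδ, hδ'⟩ : ∃ δ : ℝ, 0 < δ ∧ K / (4 * lam) * (8 * lam / C * δ) < ε / 3 := by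
    refine ⟨ε * C / (8 * K), by positivity, ?_⟩
    field_simp
    norm_num
  refine ⟨min δ 1, lt_min hδ one_pos, fun ψ h χ h' hn hn' hE hE' => ?_⟩
  have h1 := norm_sub_sq_le hC hlam h h' hn hn' hR hK hE hE'
  have h2 : K / (4 * lam) * (8 * lam / C * min δ 1) ≤ K / (4 * lam) * (8 * lam / C * δ) := by
    gcongr
    exact min_le_left δ 1
  have h3 : 1 / R ^ 2 * (2 * (minEnergy C lam + min δ 1)) ≤ 1 / R ^ 2 * M :=
    mul_le_mul_of_nonneg_left (by simp only [M]; linarith [min_le_right δ 1]) (by positivity)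
  linarith

/-- The energy of an arbitrary element of `X` of charge at most `1`. -/
theorem charge_sq_mul_minEnergy_le (hC : 0 ≤ C) (hlam : 0 < lam) {ψ : L2} (h : ψ ∈ X)
    (h1 : charge ψ ≤ 1) : charge ψ ^ 2 * minEnergy C lam ≤ energy C lam ψ := by
  rw [charge_eq_norm_sq] at *
  rcases eq_or_ne ψ 0 with rfl | h0
  · simpa using energy_nonneg hC hlam.le h
  have hpos : 0 < ‖ψ‖ := norm_pos_iff.2 h0
  set c : ℝ := ‖ψ‖⁻¹
  have hc : 1 ≤ c ^ 2 := by
    rw [inv_pow]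
    exact (one_le_inv₀ (by positivity)).2 h1
  have hmin := minEnergy_le hC hlam.le (normalize_mem_Sigma1 h h0)
  -- The quadratic terms scale by c² and the nonlinear one by at most c⁴; as c² ≥ 1, the factor c⁴
  -- serves for all.
  have hle : energy C lam ((c : ℂ) • ψ) ≤ (c ^ 2) ^ 2 * energy C lam ψ := by
    rw [energy_eq_integral C hlam.le (smul_mem_X h _), energy_eq_integral C hlam.le h,
      ← integral_const_mul]
    refine integral_mono_ae (integrable_energyDensity C hlam.le (smul_mem_X h _))
      ((integrable_energyDensity C hlam.le h).const_mul _) ?_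
    have := weakDeriv_smul h.1 (c : ℂ)
    filter_upwards [Lp.coeFn_smul (c : ℂ) ψ, Lp.coeFn_smul (c : ℂ) (weakDeriv ψ)] with s e1 e2
    simp only [energyDensity, this, e1, e2, Pi.smul_apply, norm_smul, mul_pow, Complex.norm_real,
      Real.norm_eq_abs, sq_abs]
    have i1 := mul_le_mul_of_nonneg_left
      (nonlin_mul_le hlam (sq_nonneg ‖ψ s‖) hc) hC
    have i2 : c ^ 2 ≤ (c ^ 2) ^ 2 := by nlinarith
    have i3 := mul_le_mul_of_nonneg_right i2
      (by positivity : 0 ≤ ‖weakDeriv ψ s‖ ^ 2 + s ^ 2 * ‖ψ s‖ ^ 2)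
    linarith
  have := mul_le_mul_of_nonneg_left (hmin.trans hle) (by positivity : 0 ≤ (‖ψ‖ ^ 2) ^ 2)
  rwa [← mul_assoc, ← mul_pow, ← mul_pow, mul_inv_cancel₀ hpos.ne', one_pow, one_pow,
    one_mul] at this

/-- At the arithmetic mean the parallelogram law gains ‖ψ' - χ'‖²/4 in kinetic energy, while the
other terms are convex. The mean has charge 1 - ‖ψ - χ‖²/4, so its energy falls below the minimum by
at most a multiple of ‖ψ - χ‖². -/
theorem norm_weakDeriv_sub_sq_le (hC : 0 ≤ C) (hlam : 0 < lam) {ψ χ : L2} (h : ψ ∈ Sigma1)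
    (h' : χ ∈ Sigma1) {δ : ℝ}
    (hE : energy C lam ψ ≤ minEnergy C lam + δ) (hE' : energy C lam χ ≤ minEnergy C lam + δ) :
    ‖weakDeriv ψ - weakDeriv χ‖ ^ 2 ≤ 4 * δ + 2 * minEnergy C lam * ‖ψ - χ‖ ^ 2 := by
  have hX := add_mem_X h.1 h'.1
  have hmX := smul_mem_X hX (2⁻¹ : ℂ)
  have hpar := parallelogram_law_with_norm ℂ ψ χ
  rw [norm_eq_one_of_mem_Sigma1 h, norm_eq_one_of_mem_Sigma1 h'] at hpar
  have hq : charge ((2⁻¹ : ℂ) • (ψ + χ)) = 1 - ‖ψ - χ‖ ^ 2 / 4 := by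
    rw [charge_smul, charge_eq_norm_sq, norm_inv, Complex.norm_two]
    linarith
  have hEm : 0 ≤ minEnergy C lam := Real.sInf_nonneg (by
    rintro _ ⟨χ, hχ, rfl⟩; exact energy_nonneg hC hlam.le hχ.1)
  have hmin := charge_sq_mul_minEnergy_le (C := C) hC hlam hmX
    (by rw [hq]; linarith [sq_nonneg ‖ψ - χ‖])
  have hle : energy C lam ((2⁻¹ : ℂ) • (ψ + χ)) + 1 / 4 * ‖weakDeriv ψ - weakDeriv χ‖ ^ 2 ≤
      (energy C lam ψ + energy C lam χ) / 2 := by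
    rw [energy_eq_integral C hlam.le hmX, energy_eq_integral C hlam.le h.1,
      energy_eq_integral C hlam.le h'.1, ← charge_eq_norm_sq, charge, ← integral_const_mul,
      ← integral_add (integrable_energyDensity C hlam.le hmX) ((integrable_norm_sq _).const_mul _),
      ← integral_add (integrable_energyDensity C hlam.le h.1)
        (integrable_energyDensity C hlam.le h'.1), ← integral_div]
    refine integral_mono_ae ((integrable_energyDensity C hlam.le hmX).add
      ((integrable_norm_sq _).const_mul _))
      (((integrable_energyDensity C hlam.le h.1).add
        (integrable_energyDensity C hlam.le h'.1)).div_const 2) ?_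
    have hd : weakDeriv ((2⁻¹ : ℂ) • (ψ + χ)) = (2⁻¹ : ℂ) • (weakDeriv ψ + weakDeriv χ) := by
      rw [weakDeriv_smul hX.1, weakDeriv_add h.1.1 h'.1.1]
    filter_upwards [Lp.coeFn_smul (2⁻¹ : ℂ) (ψ + χ), Lp.coeFn_add ψ χ,
      Lp.coeFn_smul (2⁻¹ : ℂ) (weakDeriv ψ + weakDeriv χ),
      Lp.coeFn_add (weakDeriv ψ) (weakDeriv χ),
      Lp.coeFn_sub (weakDeriv ψ) (weakDeriv χ)] with s e1 e2 e3 e4 e5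
    have n1 := parallelogram_law_with_norm ℂ (weakDeriv ψ s) (weakDeriv χ s)
    have n2 := parallelogram_law_with_norm ℂ (ψ s) (χ s)
    have n3 := mul_le_mul_of_nonneg_left (nonlin_midpoint_le hlam (ψ s) (χ s)) hC
    have n4 : s ^ 2 * ‖ψ s + χ s‖ ^ 2 ≤ s ^ 2 * (2 * (‖ψ s‖ ^ 2 + ‖χ s‖ ^ 2)) :=
      mul_le_mul_of_nonneg_left (by nlinarith [norm_nonneg (ψ s - χ s)]) (sq_nonneg _)
    simp only [energyDensity, hd, e1, e2, e3, e4, e5, Pi.smul_apply, Pi.add_apply, Pi.sub_apply,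
      smul_eq_mul] at *
    simp only [norm_mul, norm_inv, Complex.norm_two, mul_pow] at *
    linarith
  rw [hq] at hmin
  have hx : 0 ≤ ‖ψ - χ‖ ^ 2 := sq_nonneg _
  have : (1 - ‖ψ - χ‖ ^ 2 / 2) * minEnergy C lam ≤ (1 - ‖ψ - χ‖ ^ 2 / 4) ^ 2 * minEnergy C lam :=
    mul_le_mul_of_nonneg_right (by nlinarith) hEm
  linarith

theorem exists_dist_lt_of_energy_le (hC : 0 < C) (hlam : 0 < lam) {ε : ℝ} (hε : 0 < ε) :
    ∃ δ > 0, ∀ ψ ∈ Sigma1, ∀ χ ∈ Sigma1, IsNonneg ψ → IsNonneg χ →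
      energy C lam ψ ≤ minEnergy C lam + δ → energy C lam χ ≤ minEnergy C lam + δ →
      dist ψ χ < ε ∧ dist (weakDeriv ψ) (weakDeriv χ) < ε := by
  have hEm : 0 ≤ minEnergy C lam := Real.sInf_nonneg (by
    rintro _ ⟨χ, hχ, rfl⟩; exact energy_nonneg hC.le hlam.le hχ.1)
  set E := minEnergy C lam
  obtain ⟨δ, hδ, h⟩ := exists_norm_sub_sq_lt (C := C) (lam := lam) hC hlam
    (ε := min (ε ^ 2) (ε ^ 2 / (4 * (E + 1)))) (by positivity)
  refine ⟨min δ (ε ^ 2 / 8), by positivity, fun ψ hψ χ hχ hn hn' hE hE' => ?_⟩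
  have h1 := h ψ hψ χ hχ hn hn' (hE.trans (by gcongr; exact min_le_left _ _))
    (hE'.trans (by gcongr; exact min_le_left _ _))
  have h2 := norm_weakDeriv_sub_sq_le hC.le hlam hψ hχ hE hE'
  rw [dist_eq_norm, dist_eq_norm]
  refine ⟨lt_of_pow_lt_pow_left₀ 2 hε.le (h1.trans_le (min_le_left _ _)),
    lt_of_pow_lt_pow_left₀ 2 hε.le (h2.trans_lt ?_)⟩
  have h3 : 4 * min δ (ε ^ 2 / 8) ≤ ε ^ 2 / 2 := by linarith [min_le_right δ (ε ^ 2 / 8)]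
  have h4 := h1.trans_le (min_le_right _ _)
  rw [lt_div_iff₀ (by positivity)] at h4
  nlinarith [sq_nonneg ‖ψ - χ‖, mul_nonneg hEm (sq_nonneg ‖ψ - χ‖)]

/-! ### Existence of a ground state. -/

/-- Pairing with a test function is an L² inner product, hence continuous. It follows that the weak
derivative is a closed operator. -/
theorem tendsto_integral_smul {u : ℕ → L2} {v : L2} (h : Tendsto u atTop (𝓝 v)) {η : ℝ → ℝ}
    (hη : Continuous η) (hc : HasCompactSupport η) :
    Tendsto (fun n => ∫ s, η s • u n s) atTop (𝓝 (∫ s, η s • v s)) := by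
  have hm : MemLp (fun s => (η s : ℂ)) 2 :=
    (Complex.continuous_ofReal.comp hη).memLp_of_hasCompactSupport
      (hc.comp_left (g := fun x : ℝ => (x : ℂ)) (by simp))
  have key : ∀ w : L2, ∫ s, η s • w s = inner ℂ (hm.toLp _) w := by
    intro w
    rw [L2.inner_def]
    refine integral_congr_ae ?_
    filter_upwards [hm.coeFn_toLp] with s hs
    rw [hs]
    simp [mul_comm]
  simp only [key]
  exact ((continuous_const.inner continuous_id).tendsto v).comp h

theorem HasWeakDeriv.of_tendsto {u g : ℕ → L2} {v k : L2} (h : ∀ n, HasWeakDeriv (u n) (g n))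
    (hu : Tendsto u atTop (𝓝 v)) (hg : Tendsto g atTop (𝓝 k)) : HasWeakDeriv v k := by
  intro η h1 h2
  refine tendsto_nhds_unique (tendsto_integral_smul hu (continuous_deriv_of_contDiff h1) h2.deriv) ?_
  simp only [h _ η h1 h2]
  exact (tendsto_integral_smul hg h1.continuous h2).neg

theorem exists_subseq_tendsto_ae {u : ℕ → L2} {v : L2} (h : Tendsto u atTop (𝓝 v)) :
    ∃ ns : ℕ → ℕ, StrictMono ns ∧ ∀ᵐ s, Tendsto (fun n => u (ns n) s) atTop (𝓝 (v s)) :=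
  (tendstoInMeasure_of_tendsto_Lp h).exists_seq_tendsto_ae

/-- A ground state exists. -/
theorem groundStates_nonempty (hC : 0 < C) (hlam : 0 < lam) : (groundStates C lam).Nonempty := by
  have hex : ∀ n : ℕ, ∃ ψ ∈ Sigma1, IsNonneg ψ ∧
      energy C lam ψ < minEnergy C lam + 1 / ((n : ℝ) + 1) := fun n =>
    exists_isNonneg_energy_lt hC hlam Nat.one_div_pos_of_nat
  choose u hu hn hE using hex
  have hclose : ∀ ε > 0, ∃ N, ∀ m ≥ N, ∀ n ≥ N,
      dist (u m) (u n) < ε ∧ dist (weakDeriv (u m)) (weakDeriv (u n)) < ε := by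
    intro ε hε
    obtain ⟨δ, hδ, h⟩ := exists_dist_lt_of_energy_le (C := C) (lam := lam) hC hlam hε
    obtain ⟨N, hN⟩ := exists_nat_one_div_lt hδ
    have hle : ∀ n ≥ N, energy C lam (u n) ≤ minEnergy C lam + δ := fun n hn' => by
      have := Nat.one_div_le_one_div (α := ℝ) hn'
      linarith [hE n]
    exact ⟨N, fun m hm n hn' => h _ (hu m) _ (hu n) (hn m) (hn n) (hle m hm) (hle n hn')⟩
  have c1 : CauchySeq u := Metric.cauchySeq_iff.2 fun ε hε => by
    obtain ⟨N, hN⟩ := hclose ε hε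
    exact ⟨N, fun m hm n hn' => (hN m hm n hn').1⟩
  have c2 : CauchySeq fun n => weakDeriv (u n) := Metric.cauchySeq_iff.2 fun ε hε => by
    obtain ⟨N, hN⟩ := hclose ε hε
    exact ⟨N, fun m hm n hn' => (hN m hm n hn').2⟩
  obtain ⟨v, hv⟩ := cauchySeq_tendsto_of_complete c1
  obtain ⟨k, hk⟩ := cauchySeq_tendsto_of_complete c2
  have hvk : HasWeakDeriv v k := .of_tendsto (fun n => hasWeakDeriv_weakDeriv (hu n).1.1) hv hk
  -- Two successive extractions, so that functions and derivatives converge almost everywhere along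
  -- one subsequence.
  obtain ⟨n1, hn1, ha1⟩ := exists_subseq_tendsto_ae hv
  obtain ⟨n2, hn2, ha2⟩ := exists_subseq_tendsto_ae (hk.comp hn1.tendsto_atTop)
  set e : ℕ → ℝ → ℝ := fun n => energyDensity C lam (u (n1 (n2 n)))
  have hconv : ∀ᵐ s, Tendsto (fun n => e n s) atTop (𝓝 (energyDensity C lam v s)) := by
    filter_upwards [ha1, ha2] with s h1 h2
    have h1 := h1.comp hn2.tendsto_atTop
    simp only [e, energyDensity, hvk.weakDeriv_eq]
    exact (((h2.norm.pow 2).add ((h1.norm.pow 2).const_mul _)).add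
      ((((continuous_nonlin lam).tendsto _).comp (h1.norm.pow 2)).const_mul C))
  have hint : ∀ n, Integrable (e n) := fun n => integrable_energyDensity C hlam.le (hu _).1
  have hEn : ∀ n, ∫⁻ s, ENNReal.ofReal (e n s) =
      ENNReal.ofReal (energy C lam (u (n1 (n2 n)))) := fun n => by
    rw [energy_eq_integral C hlam.le (hu _).1, ofReal_integral_eq_lintegral_ofReal (hint n)
      (ae_of_all _ fun s => energyDensity_nonneg hC.le _ _ _)]
  have hElim : Tendsto (fun n => energy C lam (u (n1 (n2 n)))) atTop (𝓝 (minEnergy C lam)) := by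
    have h0 : Tendsto (fun n => energy C lam (u n)) atTop (𝓝 (minEnergy C lam)) := by
      refine tendsto_of_tendsto_of_tendsto_of_le_of_le tendsto_const_nhds ?_
        (fun n => minEnergy_le hC.le hlam.le (hu n)) (fun n => (hE n).le)
      simpa using tendsto_const_nhds.add (tendsto_one_div_add_atTop_nhds_zero_nat (𝕜 := ℝ))
    exact h0.comp (hn1.comp hn2).tendsto_atTop
  -- Fatou's lemma is applied to the whole density in extended nonnegative form, since the
  -- integrability of the limit density is not yet known and is deduced from this bound.
  have hfatou : ∫⁻ s, ENNReal.ofReal (energyDensity C lam v s) ≤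
      ENNReal.ofReal (minEnergy C lam) := by
    have h1 : ∫⁻ s, ENNReal.ofReal (energyDensity C lam v s) =
        ∫⁻ s, liminf (fun n => ENNReal.ofReal (e n s)) atTop := by
      refine lintegral_congr_ae ?_
      filter_upwards [hconv] with s hs
      exact (ENNReal.tendsto_ofReal hs).liminf_eq.symm
    rw [h1]
    refine (lintegral_liminf_le' fun n => (hint n).aemeasurable.ennreal_ofReal).trans ?_
    simp only [hEn]
    exact (ENNReal.tendsto_ofReal hElim).liminf_eq.le
  have hmeas : AEStronglyMeasurable (energyDensity C lam v) :=
    aestronglyMeasurable_of_tendsto_ae atTop (fun n => (hint n).aestronglyMeasurable) hconv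
  have hpos : 0 ≤ᵐ[volume] energyDensity C lam v :=
    ae_of_all _ fun s => energyDensity_nonneg hC.le _ _ _
  have hvint : Integrable (energyDensity C lam v) :=
    (lintegral_ofReal_ne_top_iff_integrable hmeas hpos).1 (hfatou.trans_lt ENNReal.ofReal_lt_top).ne
  have hvX : v ∈ X := by
    refine mem_X_of_hasWeakDeriv hvk (hvint.mono
      ((continuous_pow 2).aestronglyMeasurable.mul ((Lp.aestronglyMeasurable v).norm.fun_pow 2))
      (ae_of_all _ fun s => ?_))
    rw [Real.norm_of_nonneg (by positivity),
      Real.norm_of_nonneg (energyDensity_nonneg hC.le _ _ _)]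
    have := mul_nonneg hC.le (nonlin_nonneg (lam := lam) (sq_nonneg ‖v s‖))
    have := sq_nonneg ‖weakDeriv v s‖
    simp only [energyDensity]
    linarith
  have hvS : v ∈ Sigma1 := by
    refine ⟨hvX, ?_⟩
    have : ‖v‖ = 1 := tendsto_nhds_unique hv.norm (by
      simp only [fun n => norm_eq_one_of_mem_Sigma1 (hu n)]
      exact tendsto_const_nhds)
    rw [charge_eq_norm_sq, this, one_pow]
  refine ⟨v, hvS, le_antisymm ?_ (minEnergy_le hC.le hlam.le hvS)⟩
  have hEm : 0 ≤ minEnergy C lam := Real.sInf_nonneg (by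
    rintro _ ⟨χ, hχ, rfl⟩; exact energy_nonneg hC.le hlam.le hχ.1)
  rw [energy_eq_integral C hlam.le hvX, ← ENNReal.ofReal_le_ofReal_iff hEm,
    ofReal_integral_eq_lintegral_ofReal hvint hpos]
  exact hfatou

/-! ### Uniqueness of the modulus and of the nonnegative ground state. -/

/-- All ground states have the same modulus. -/
theorem norm_ae_eq_of_mem_groundStates (hC : 0 < C) (hlam : 0 < lam) {ψ χ : L2}
    (h : ψ ∈ groundStates C lam) (h' : χ ∈ groundStates C lam) : ∀ᵐ s, ‖ψ s‖ = ‖χ s‖ := by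
  obtain ⟨m, hm, -, hm2⟩ := exists_quadraticMean_energy_add_le hC.le hlam h.1 h'.1
  have hmin := minEnergy_le hC.le hlam.le hm
  rw [h.2, h'.2] at hm2
  have i := integrable_sq_sub_amplitude hlam ψ χ
  have h0 : 0 ≤ ∫ s, (√(1 + 2 * lam * ‖ψ s‖ ^ 2) - √(1 + 2 * lam * ‖χ s‖ ^ 2)) ^ 2 :=
    integral_nonneg fun _ => sq_nonneg _
  -- Both energies equal the minimum, which the quadratic mean cannot undercut, so the convexity gap
  -- is zero.
  have h1 : C / (8 * lam) *
      ∫ s, (√(1 + 2 * lam * ‖ψ s‖ ^ 2) - √(1 + 2 * lam * ‖χ s‖ ^ 2)) ^ 2 ≤ 0 := by linarith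
  have h2 := le_antisymm (nonpos_of_mul_nonpos_right h1 (by positivity)) h0
  rw [integral_eq_zero_iff_of_nonneg (fun _ => sq_nonneg _) i] at h2
  filter_upwards [h2] with s hs
  have hs := sub_eq_zero.1 (pow_eq_zero_iff two_ne_zero |>.1 hs)
  rw [Real.sqrt_inj (by positivity) (by positivity), add_right_inj,
    mul_right_inj' (by positivity)] at hs
  exact (pow_left_inj₀ (norm_nonneg _) (norm_nonneg _) two_ne_zero).1 hs

theorem eq_of_isNonneg_of_mem_groundStates (hC : 0 < C) (hlam : 0 < lam) {ψ χ : L2}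
    (h : ψ ∈ groundStates C lam) (h' : χ ∈ groundStates C lam) (hn : IsNonneg ψ)
    (hn' : IsNonneg χ) : ψ = χ := by
  refine Lp.ext ?_
  filter_upwards [norm_ae_eq_of_mem_groundStates hC hlam h h', hn, hn'] with s h1 h2 h3
  rw [h2, h3, h1]

theorem exists_isNonneg_mem_groundStates (hC : 0 < C) (hlam : 0 < lam) :
    ∃ φ ∈ groundStates C lam, IsNonneg φ := by
  obtain ⟨ψ, hψ⟩ := groundStates_nonempty hC hlam
  obtain ⟨m, hm, hm1, hm2⟩ := exists_quadraticMean_energy_add_le hC.le hlam hψ.1 hψ.1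
  refine ⟨m, ⟨hm, le_antisymm ?_ (minEnergy_le hC.le hlam.le hm)⟩,
    isNonneg_of_ae_eq (fun s => Real.sqrt_nonneg _) hm1⟩
  rw [hψ.2] at hm2
  simp only [sub_self, ne_eq, OfNat.ofNat_ne_zero, not_false_eq_true, zero_pow, integral_zero,
    mul_zero, add_zero] at hm2
  linarith

/-! ### The Euler–Lagrange equation. -/

/-- Scaling down to charge 1 decreases every term. Ground states thus minimise over all charges at
least 1, and perturbations need not be renormalised. -/
theorem minEnergy_le_of_one_le_charge (hC : 0 ≤ C) (hlam : 0 < lam) {ψ : L2} (h : ψ ∈ X)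
    (h1 : 1 ≤ charge ψ) : minEnergy C lam ≤ energy C lam ψ := by
  rw [charge_eq_norm_sq] at h1
  have h0 : ψ ≠ 0 := by
    rintro rfl
    norm_num at h1
  have hpos : 0 < ‖ψ‖ := norm_pos_iff.2 h0
  set c : ℝ := ‖ψ‖⁻¹
  have hc : c ^ 2 ≤ 1 := by
    rw [inv_pow]
    exact inv_le_one_of_one_le₀ h1
  suffices hle : energy C lam ((c : ℂ) • ψ) ≤ energy C lam ψ from
    (minEnergy_le hC hlam.le (normalize_mem_Sigma1 h h0)).trans hle
  rw [energy_eq_integral C hlam.le (smul_mem_X h _), energy_eq_integral C hlam.le h]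
  refine integral_mono_ae (integrable_energyDensity C hlam.le (smul_mem_X h _))
    (integrable_energyDensity C hlam.le h) ?_
  have := weakDeriv_smul h.1 (c : ℂ)
  filter_upwards [Lp.coeFn_smul (c : ℂ) ψ, Lp.coeFn_smul (c : ℂ) (weakDeriv ψ)] with s e1 e2
  simp only [energyDensity, this, e1, e2, Pi.smul_apply, norm_smul, mul_pow, Complex.norm_real,
    Real.norm_eq_abs, sq_abs]
  have i1 : c ^ 2 * ‖ψ s‖ ^ 2 ≤ ‖ψ s‖ ^ 2 := mul_le_of_le_one_left (sq_nonneg _) hc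
  have i2 : c ^ 2 * ‖weakDeriv ψ s‖ ^ 2 ≤ ‖weakDeriv ψ s‖ ^ 2 :=
    mul_le_of_le_one_left (sq_nonneg _) hc
  have i3 := nonlin_mono hlam.le (by positivity) i1
  gcongr

theorem nonlinDeriv_nonneg (hlam : 0 ≤ lam) {ρ : ℝ} (hρ : 0 ≤ ρ) : 0 ≤ nonlinDeriv lam ρ := by
  unfold nonlinDeriv
  positivity

theorem nonlinDeriv_le (hlam : 0 < lam) {ρ : ℝ} (hρ : 0 ≤ ρ) :
    nonlinDeriv lam ρ ≤ 1 + 3 * lam * ρ :=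
  div_le_self (by positivity) (one_le_sqrt_amplitude hlam hρ)

theorem continuous_nonlinDeriv_sq (hlam : 0 ≤ lam) :
    Continuous fun r : ℝ => nonlinDeriv lam (r ^ 2) := by
  unfold nonlinDeriv
  refine Continuous.div (by fun_prop) (by fun_prop) fun r => ?_
  positivity

/-- The density of the first variation of the energy at `ψ` in the direction `η`. -/
def firstVariation (C lam : ℝ) (ψ η : L2) (s : ℝ) : ℝ :=
  (weakDeriv η s * starRingEnd ℂ (weakDeriv ψ s)).re +
    (s ^ 2 + C * nonlinDeriv lam (‖ψ s‖ ^ 2)) * (η s * starRingEnd ℂ (ψ s)).re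

theorem integrable_re_mul_conj (ψ η : L2) :
    Integrable fun s => (η s * starRingEnd ℂ (ψ s)).re := by
  have := (L2.integrable_inner (𝕜 := ℂ) ψ η).re
  simpa [RCLike.inner_apply] using this

theorem re_inner_eq_integral (ψ η : L2) :
    (inner ℂ ψ η).re = ∫ s, (η s * starRingEnd ℂ (ψ s)).re := by
  rw [L2.inner_def]
  exact (integral_re (L2.integrable_inner (𝕜 := ℂ) ψ η)).symm

theorem integrable_firstVariation (C : ℝ) (hlam : 0 < lam) {ψ η : L2} (h : ψ ∈ X) (h' : η ∈ X) :
    Integrable (firstVariation C lam ψ η) := by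
  obtain ⟨M, hM0, hM⟩ := (hasWeakDeriv_weakDeriv h.1).exists_norm_le
  have m1 := (integrable_re_mul_conj ψ η).aestronglyMeasurable
  refine (integrable_re_mul_conj _ _).add ?_
  have i1 : Integrable fun s : ℝ => s ^ 2 * (η s * starRingEnd ℂ (ψ s)).re := by
    refine ((integrable_weight h).add (integrable_weight h')).mono
      ((continuous_pow 2).aestronglyMeasurable.mul m1) (ae_of_all _ fun s => ?_)
    rw [norm_mul, Real.norm_of_nonneg (sq_nonneg s), Real.norm_eq_abs (Complex.re _),
      Pi.add_apply, ← mul_add]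
    refine (mul_le_mul_of_nonneg_left ((re_mul_conj_sq_le _ _).trans ?_) (sq_nonneg _)).trans
      (le_abs_self _)
    nlinarith [sq_nonneg (‖η s‖ - ‖ψ s‖), sq_nonneg ‖η s‖, sq_nonneg ‖ψ s‖]
  have i2 : Integrable fun s : ℝ =>
      nonlinDeriv lam (‖ψ s‖ ^ 2) * (η s * starRingEnd ℂ (ψ s)).re := by
    refine (integrable_re_mul_conj ψ η).bdd_mul (c := 1 + 3 * lam * M ^ 2)
      ((continuous_nonlinDeriv_sq hlam.le).comp_aestronglyMeasurable
        (Lp.aestronglyMeasurable ψ).norm) ?_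
    filter_upwards [hM] with s hs
    rw [Real.norm_of_nonneg (nonlinDeriv_nonneg hlam.le (sq_nonneg _))]
    refine (nonlinDeriv_le hlam (sq_nonneg _)).trans ?_
    gcongr
  refine (i1.add (i2.const_mul C)).congr (ae_of_all _ fun s => ?_)
  simp only [Pi.add_apply]
  ring

theorem norm_add_smul_sq (z w : ℂ) (t : ℝ) :
    ‖z + (t : ℂ) * w‖ ^ 2 = ‖z‖ ^ 2 + (2 * t * (w * starRingEnd ℂ z).re + t ^ 2 * ‖w‖ ^ 2) := by
  simp only [Complex.sq_norm, Complex.normSq_apply, Complex.add_re, Complex.add_im,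
    Complex.mul_re, Complex.mul_im, Complex.ofReal_re, Complex.ofReal_im, Complex.conj_re,
    Complex.conj_im]
  ring

/-- A quadratic upper bound for the energy near `ψ`. -/
theorem exists_energy_add_smul_le (hC : 0 ≤ C) (hlam : 0 < lam) {ψ η : L2} (h : ψ ∈ X)
    (h' : η ∈ X) : ∃ K, ∀ t : ℝ, |t| ≤ 1 → energy C lam (ψ + (t : ℂ) • η) ≤
      energy C lam ψ + 2 * t * (∫ s, firstVariation C lam ψ η s) + t ^ 2 * K := by
  obtain ⟨M, hM0, hM⟩ := (hasWeakDeriv_weakDeriv h.1).exists_norm_le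
  obtain ⟨N, hN0, hN⟩ := (hasWeakDeriv_weakDeriv h'.1).exists_norm_le
  set Q : ℝ → ℝ := fun s => ‖weakDeriv η s‖ ^ 2 + s ^ 2 * ‖η s‖ ^ 2 +
    C * (1 + 3 * lam * M ^ 2 + lam * (2 * M + N) ^ 2) * ‖η s‖ ^ 2
  have iQ : Integrable Q := ((integrable_norm_sq _).add (integrable_weight h')).add
    ((integrable_norm_sq _).const_mul _)
  refine ⟨∫ s, Q s, fun t ht => ?_⟩
  have hX : ψ + (t : ℂ) • η ∈ X := add_mem_X h (smul_mem_X h' _)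
  have iE := integrable_energyDensity C hlam.le h
  have iF := integrable_firstVariation C hlam h h'
  rw [energy_eq_integral C hlam.le hX, energy_eq_integral C hlam.le h, ← integral_const_mul,
    ← integral_const_mul, ← integral_add iE (iF.const_mul _)]
  have e := integral_add (iE.add (iF.const_mul (2 * t))) (iQ.const_mul (t ^ 2))
  simp only [Pi.add_apply] at e
  rw [← e]
  refine integral_mono_ae (integrable_energyDensity C hlam.le hX)
    ((iE.add (iF.const_mul _)).add (iQ.const_mul _)) ?_
  have hd : weakDeriv (ψ + (t : ℂ) • η) = weakDeriv ψ + (t : ℂ) • weakDeriv η := by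
    rw [weakDeriv_add h.1 (smul_mem_X h' _).1, weakDeriv_smul h'.1]
  filter_upwards [hM, hN, Lp.coeFn_add ψ ((t : ℂ) • η), Lp.coeFn_smul (t : ℂ) η,
    Lp.coeFn_add (weakDeriv ψ) ((t : ℂ) • weakDeriv η),
    Lp.coeFn_smul (t : ℂ) (weakDeriv η)] with s b1 b2 e1 e2 e3 e4
  simp only [energyDensity, firstVariation, Q, hd, e1, e2, e3, e4, Pi.add_apply, Pi.smul_apply,
    smul_eq_mul]
  have hnn : 0 ≤ ‖ψ s + (t : ℂ) * η s‖ ^ 2 := sq_nonneg _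
  rw [norm_add_smul_sq] at hnn
  rw [norm_add_smul_sq, norm_add_smul_sq]
  have hre := re_mul_conj_sq_le (η s) (ψ s)
  set r := (η s * starRingEnd ℂ (ψ s)).re
  have hnl := nonlin_le_tangent_add hlam (sq_nonneg ‖ψ s‖) hnn
  rw [add_sub_cancel_left] at hnl
  have hD : nonlinDeriv lam (‖ψ s‖ ^ 2) ≤ 1 + 3 * lam * M ^ 2 := by
    refine (nonlinDeriv_le hlam (sq_nonneg _)).trans ?_
    gcongr
  -- As |t| ≤ 1 and ψ, η are bounded, the change of density is O(|t|‖η‖), so its square is t² times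
  -- an integrable function.
  have hδ : (2 * t * r + t ^ 2 * ‖η s‖ ^ 2) ^ 2 ≤ t ^ 2 * ((2 * M + N) ^ 2 * ‖η s‖ ^ 2) := by
    have h1 : |2 * t * r + t ^ 2 * ‖η s‖ ^ 2| ≤ |t| * ((2 * M + N) * ‖η s‖) := by
      have a1 : |2 * t * r| = |t| * (2 * |r|) := by rw [abs_mul, abs_mul, abs_two]; ring
      have a2 : |t ^ 2 * ‖η s‖ ^ 2| ≤ |t| * (N * ‖η s‖) := by
        rw [abs_of_nonneg (by positivity), ← sq_abs t, sq, mul_assoc]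
        refine mul_le_mul_of_nonneg_left ?_ (abs_nonneg _)
        rw [sq]
        calc |t| * (‖η s‖ * ‖η s‖) ≤ 1 * (N * ‖η s‖) := by gcongr
          _ = _ := one_mul _
      have a3 : 2 * |r| ≤ 2 * M * ‖η s‖ := by nlinarith [norm_nonneg (η s)]
      have a4 := mul_le_mul_of_nonneg_left a3 (abs_nonneg t)
      have := abs_add_le (2 * t * r) (t ^ 2 * ‖η s‖ ^ 2)
      rw [a1] at this
      linarith
    rw [← sq_abs]
    refine (pow_le_pow_left₀ (abs_nonneg _) h1 2).trans_eq ?_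
    rw [mul_pow, mul_pow, sq_abs]
  have hD2 := mul_le_mul_of_nonneg_right hD (by positivity : 0 ≤ t ^ 2 * ‖η s‖ ^ 2)
  have hδ2 := mul_le_mul_of_nonneg_left hδ hlam.le
  have hfin : nonlin lam (‖ψ s‖ ^ 2 + (2 * t * r + t ^ 2 * ‖η s‖ ^ 2)) ≤
      nonlin lam (‖ψ s‖ ^ 2) + 2 * t * (nonlinDeriv lam (‖ψ s‖ ^ 2) * r) +
      t ^ 2 * ((1 + 3 * lam * M ^ 2 + lam * (2 * M + N) ^ 2) * ‖η s‖ ^ 2) := by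
    linarith
  have := mul_le_mul_of_nonneg_left hfin hC
  linarith

theorem eq_zero_of_forall_le_sq {a K : ℝ} (h : ∀ t : ℝ, |t| ≤ 1 → 0 ≤ 2 * t * a + t ^ 2 * K) :
    a = 0 := by
  by_contra ha
  set b := |a| + |K|
  have ha' : 0 < |a| := abs_pos.2 ha
  have hb : 0 < b := by positivity
  -- In b = |a| + |K|, the summand |a| keeps |t| ≤ 1 and |K| makes K - 2b negative.
  have h1 := h (-a / b) (by
    rw [abs_div, abs_neg, abs_of_pos hb, div_le_one hb]
    linarith [abs_nonneg K])
  have h2 : 2 * (-a / b) * a + (-a / b) ^ 2 * K = a ^ 2 / b ^ 2 * (K - 2 * b) := by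
    field_simp
    ring
  rw [h2] at h1
  have h3 : 0 < a ^ 2 / b ^ 2 := by positivity
  have h4 := nonneg_of_mul_nonneg_right h1 h3
  linarith [le_abs_self K, abs_nonneg K]

/-- For η real-orthogonal to ψ the charge of ψ + tη is 1 + t²‖η‖² ≥ 1, so the energy cannot drop
below the minimum for either sign of t, and the linear term vanishes. -/
theorem integral_firstVariation_eq_zero (hC : 0 ≤ C) (hlam : 0 < lam) {ψ η : L2}
    (h : ψ ∈ groundStates C lam) (h' : η ∈ X) (ho : (inner ℂ ψ η).re = 0) :
    ∫ s, firstVariation C lam ψ η s = 0 := by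
  obtain ⟨K, hK⟩ := exists_energy_add_smul_le hC hlam h.1.1 h'
  refine eq_zero_of_forall_le_sq (K := K) fun t ht => ?_
  have h1 := hK t ht
  have h2 : 1 ≤ charge (ψ + (t : ℂ) • η) := by
    have h3 : RCLike.re (inner ℂ ψ ((t : ℂ) • η)) = 0 := by
      rw [inner_smul_right]
      simp [ho]
    rw [charge_eq_norm_sq, @norm_add_sq ℂ, h3, norm_eq_one_of_mem_Sigma1 h.1]
    linarith [sq_nonneg ‖(t : ℂ) • η‖]
  have h3 := minEnergy_le_of_one_le_charge hC hlam
    (add_mem_X h.1.1 (smul_mem_X h' (t : ℂ))) h2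
  rw [h.2] at h1
  linarith

/-- The Euler-Lagrange equation in weak form. -/
theorem exists_integral_firstVariation_eq (hC : 0 ≤ C) (hlam : 0 < lam) {ψ : L2}
    (h : ψ ∈ groundStates C lam) :
    ∃ μ : ℝ, ∀ η ∈ X, ∫ s, firstVariation C lam ψ η s =
      μ * ∫ s, (η s * starRingEnd ℂ (ψ s)).re := by
  -- The multiplier is the variation in the direction ψ itself; subtracting Re⟨ψ, η⟩ ψ from η leaves
  -- an orthogonal direction.
  refine ⟨∫ s, firstVariation C lam ψ ψ s, fun η hη => ?_⟩
  have hψ := h.1.1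
  set r : ℝ := (inner ℂ ψ η).re
  have hX : η + ((-r : ℝ) : ℂ) • ψ ∈ X := add_mem_X hη (smul_mem_X hψ _)
  have h0 := integral_firstVariation_eq_zero hC hlam h hX (by
    rw [inner_add_right, inner_smul_right, inner_self_eq_norm_sq_to_K,
      norm_eq_one_of_mem_Sigma1 h.1]
    simp [r])
  have hd : weakDeriv (η + ((-r : ℝ) : ℂ) • ψ) = weakDeriv η + ((-r : ℝ) : ℂ) • weakDeriv ψ := by
    rw [weakDeriv_add hη.1 (smul_mem_X hψ _).1, weakDeriv_smul hψ.1]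
  have h1 : ∫ s, firstVariation C lam ψ (η + ((-r : ℝ) : ℂ) • ψ) s =
      ∫ s, (firstVariation C lam ψ η s - r * firstVariation C lam ψ ψ s) := by
    refine integral_congr_ae ?_
    filter_upwards [Lp.coeFn_add η (((-r : ℝ) : ℂ) • ψ), Lp.coeFn_smul ((-r : ℝ) : ℂ) ψ,
      Lp.coeFn_add (weakDeriv η) (((-r : ℝ) : ℂ) • weakDeriv ψ),
      Lp.coeFn_smul ((-r : ℝ) : ℂ) (weakDeriv ψ)] with s e1 e2 e3 e4
    simp only [firstVariation, hd, e1, e2, e3, e4, Pi.add_apply, Pi.smul_apply, smul_eq_mul,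
      add_mul, mul_assoc, Complex.add_re, Complex.re_ofReal_mul]
    ring
  rw [h1, integral_sub (integrable_firstVariation C hlam hψ hη)
    ((integrable_firstVariation C hlam hψ hψ).const_mul _), integral_const_mul] at h0
  rw [← re_inner_eq_integral]
  linarith

theorem IsPrimitive.hasDerivAt {U g : ℝ → ℂ} (h : IsPrimitive U g) (hg : Continuous g) (x : ℝ) :
    HasDerivAt U (g x) x := by
  rw [show U = fun x => U 0 + ∫ t in (0:ℝ)..x, g t from funext h.eq_add_integral]
  exact (hg.integral_hasStrictDerivAt _ _).hasDerivAt.const_add _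

theorem integral_test_eq (hC : 0 ≤ C) (hlam : 0 < lam) {ψ : L2} (h : ψ ∈ groundStates C lam) :
    ∃ μ : ℝ, ∀ U : ℝ → ℂ, Continuous U → ψ =ᵐ[volume] U →
      ∀ ζ : ℝ → ℝ, ContDiff ℝ ∞ ζ → HasCompactSupport ζ →
      ∫ s, deriv ζ s • weakDeriv ψ s =
        -∫ s, ζ s • ((s ^ 2 + C * nonlinDeriv lam (‖U s‖ ^ 2) - μ) • U s) := by
  obtain ⟨μ, hμ⟩ := exists_integral_firstVariation_eq hC hlam h
  refine ⟨μ, fun U hUc hU ζ hζ hζc => ?_⟩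
  have hd := continuous_deriv_of_contDiff hζ
  have hdiff : Differentiable ℝ ζ := hζ.differentiable (by simp)
  have hcont : Continuous fun s => (s ^ 2 + C * nonlinDeriv lam (‖U s‖ ^ 2) - μ) • U s := by
    have : Continuous fun s => nonlinDeriv lam (‖U s‖ ^ 2) :=
      (continuous_nonlinDeriv_sq hlam.le).comp hUc.norm
    exact (((continuous_pow 2).add (continuous_const.mul this)).sub continuous_const).smul hUc
  -- The first variation sees only real parts. Testing with cζ for complex c, in the end c = 1 and c
  -- = i, recovers the complex identity.
  have key : ∀ c : ℂ, (c * starRingEnd ℂ (∫ s, deriv ζ s • weakDeriv ψ s)).re =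
      (c * starRingEnd ℂ
        (-∫ s, ζ s • ((s ^ 2 + C * nonlinDeriv lam (‖U s‖ ^ 2) - μ) • U s))).re := by
    intro c
    have hP : IsPrimitive (fun s => c * (ζ s : ℂ)) (fun s => c * ((deriv ζ s : ℝ) : ℂ)) :=
      isPrimitive_of_hasDerivAt (fun x => (hdiff x).hasDerivAt.ofReal_comp.const_mul c)
        (by fun_prop)
    have sq : ∀ {η : ℝ → ℝ}, HasCompactSupport η →
        HasCompactSupport fun s => ‖c * (η s : ℂ)‖ ^ 2 :=
      fun h => h.comp_left (g := fun x : ℝ => ‖c * (x : ℂ)‖ ^ 2) (by simp)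
    have hζ' := hζ.continuous
    obtain ⟨η, hη, h1, h2⟩ := exists_mem_X_of_isPrimitive hP
      (Continuous.integrable_of_hasCompactSupport (by fun_prop) (sq hζc))
      (Continuous.integrable_of_hasCompactSupport (by fun_prop) (sq hζc.deriv))
      (Continuous.integrable_of_hasCompactSupport (by fun_prop) (sq hζc).mul_left)
    have hfv := hμ η hη
    have hre : ∀ {f : ℝ → ℂ}, Integrable f →
        (c * starRingEnd ℂ (∫ s, f s)).re = ∫ s, (c * starRingEnd ℂ (f s)).re := by
      intro f hf
      have := ((Complex.reCLM.comp ((ContinuousLinearMap.mul ℝ ℂ c).comp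
        (Complex.conjCLE : ℂ →L[ℝ] ℂ))).integral_comp_comm hf).symm
      simpa using this
    have i1 : Integrable fun s => deriv ζ s • weakDeriv ψ s :=
      L2.integrable_smul _ hd hζc.deriv
    have i2 : Integrable fun s =>
        ζ s • ((s ^ 2 + C * nonlinDeriv lam (‖U s‖ ^ 2) - μ) • U s) :=
      (hζ'.smul hcont).integrable_of_hasCompactSupport hζc.smul_right
    have hreI : ∀ {f : ℝ → ℂ}, Integrable f →
        Integrable fun s => (c * starRingEnd ℂ (f s)).re := by
      intro f hf
      have := (Complex.reCLM.comp ((ContinuousLinearMap.mul ℝ ℂ c).comp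
        (Complex.conjCLE : ℂ →L[ℝ] ℂ))).integrable_comp hf
      simpa using this
    have hre2 := hre i2.neg
    have hreI2 := hreI i2.neg
    simp only [Pi.neg_apply] at hre2 hreI2
    rw [← integral_neg, hre i1, hre2, ← sub_eq_zero, ← integral_sub (hreI i1) hreI2]
    · rw [← integral_const_mul, ← sub_eq_zero,
        ← integral_sub (integrable_firstVariation C hlam h.1.1 hη)
          ((integrable_re_mul_conj ψ η).const_mul μ)] at hfv
      rw [← hfv]
      refine integral_congr_ae ?_
      filter_upwards [hU, h1, h2] with s e1 e2 e3
      simp only [firstVariation, e1, e2, e3, Complex.real_smul, map_mul, map_neg,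
        Complex.conj_ofReal, mul_assoc, mul_left_comm c, mul_neg, Complex.neg_re,
        Complex.re_ofReal_mul]
      ring
  have k1 := key 1
  have k2 := key Complex.I
  simp only [one_mul, Complex.conj_re, Complex.I_mul_re, Complex.conj_im, neg_neg] at k1 k2
  exact Complex.ext k1 k2

/-- Ground states are classical solutions of the Euler-Lagrange equation. -/
theorem exists_classical_solution (hC : 0 ≤ C) (hlam : 0 < lam) {ψ : L2}
    (h : ψ ∈ groundStates C lam) :
    ∃ (μ : ℝ) (U V : ℝ → ℂ), ψ =ᵐ[volume] U ∧ weakDeriv ψ =ᵐ[volume] V ∧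
      (∀ x, HasDerivAt U (V x) x) ∧
      ∀ x, HasDerivAt V ((x ^ 2 + C * nonlinDeriv lam (‖U x‖ ^ 2) - μ) • U x) x := by
  obtain ⟨μ, hμ⟩ := integral_test_eq hC hlam h
  obtain ⟨U, hU, hψU⟩ := (hasWeakDeriv_weakDeriv h.1.1.1).exists_isPrimitive
  have hcont : Continuous fun s => (s ^ 2 + C * nonlinDeriv lam (‖U s‖ ^ 2) - μ) • U s := by
    have : Continuous fun s => nonlinDeriv lam (‖U s‖ ^ 2) :=
      (continuous_nonlinDeriv_sq hlam.le).comp hU.continuous.norm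
    exact (((continuous_pow 2).add (continuous_const.mul this)).sub continuous_const).smul hU.continuous
  obtain ⟨V, hV, hψV⟩ := exists_isPrimitive_of_weak (L2.locallyIntegrable (weakDeriv ψ))
    hcont.locallyIntegrable (hμ U hU.continuous hψU)
  exact ⟨μ, U, V, hψU, hψV, (hU.congr_right hψV).hasDerivAt hV.continuous, hV.hasDerivAt hcont⟩

/-! ### The real profile and tools for second order equations. -/

theorem eq_of_ae_eq_of_continuous {E : Type*} [TopologicalSpace E] [T2Space E] {f g : ℝ → E}
    (hf : Continuous f) (hg : Continuous g) (h : ∀ᵐ x, f x = g x) (x : ℝ) : f x = g x :=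
  congrFun ((Continuous.ae_eq_iff_eq volume hf hg).1 h) x

theorem continuous_of_hasDerivAt {E : Type*} [NormedAddCommGroup E] [NormedSpace ℝ E]
    {f f' : ℝ → E} (h : ∀ x, HasDerivAt f (f' x) x) : Continuous f :=
  continuous_iff_continuousAt.2 fun x => (h x).continuousAt

/-- `u` is the continuous representative of the nonnegative function `φ`, a classical solution of
the Euler-Lagrange equation with Lagrange multiplier `μ`, and `v` is its derivative. -/
structure IsRealProfile (C lam μ : ℝ) (φ : L2) (u v : ℝ → ℝ) : Prop where
  ae_eq : ∀ᵐ s, φ s = (u s : ℂ)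
  weakDeriv_ae_eq : ∀ᵐ s, weakDeriv φ s = (v s : ℂ)
  nonneg : ∀ x, 0 ≤ u x
  hasDerivAt : ∀ x, HasDerivAt u (v x) x
  hasDerivAt' : ∀ x, HasDerivAt v ((x ^ 2 + C * nonlinDeriv lam (u x ^ 2) - μ) * u x) x

theorem exists_isRealProfile (hC : 0 ≤ C) (hlam : 0 < lam) {φ : L2} (h : φ ∈ groundStates C lam)
    (hn : IsNonneg φ) : ∃ μ u v, IsRealProfile C lam μ φ u v := by
  obtain ⟨μ, U, V, hU, hV, hUV, hVV⟩ := exists_classical_solution hC hlam h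
  have hUc := continuous_of_hasDerivAt hUV
  have hre : ∀ x, U x = (‖U x‖ : ℂ) := eq_of_ae_eq_of_continuous hUc
    (Complex.continuous_ofReal.comp hUc.norm) (by
      filter_upwards [hn, hU] with s h1 h2
      rw [← h2]
      exact h1)
  have hnorm : ∀ x, ‖U x‖ = (U x).re := fun x => by
    conv_rhs => rw [hre x, Complex.ofReal_re]
  have hud : ∀ x, HasDerivAt (fun x => (U x).re) (V x).re x := fun x =>
    Complex.reCLM.hasFDerivAt.comp_hasDerivAt x (hUV x)
  have hVre : ∀ x, V x = ((V x).re : ℂ) := fun x => by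
    have h1 := (hud x).ofReal_comp
    have h2 : (fun x => ((U x).re : ℂ)) = U := funext fun x => by
      rw [← hnorm x, ← hre x]
    rw [h2] at h1
    exact (hUV x).unique h1
  refine ⟨μ, fun x => (U x).re, fun x => (V x).re, ?_, ?_, ?_, hud, ?_⟩
  · filter_upwards [hU] with s hs
    rw [hs, ← hnorm, ← hre]
  · filter_upwards [hV] with s hs
    rw [hs, ← hVre]
  · intro x
    rw [← hnorm]
    exact norm_nonneg _
  · intro x
    have h1 := Complex.reCLM.hasFDerivAt.comp_hasDerivAt x (hVV x)
    rw [hnorm, Complex.reCLM_apply, Complex.real_smul, Complex.re_ofReal_mul] at h1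
    exact h1

theorem hasDerivAt_deriv_deriv {f f' : ℝ → ℝ} {a c : ℝ} (h : ∀ x, HasDerivAt f (f' x) x)
    (h' : HasDerivAt f' c a) : deriv (deriv f) a = c := by
  rw [show deriv f = f' from funext fun x => (h x).deriv]
  exact h'.deriv

/-- If c were negative, the point would also be a local maximum, so f would be locally constant and
c zero. -/
theorem second_deriv_nonneg_of_isLocalMin {f f' : ℝ → ℝ} {a c : ℝ}
    (h : ∀ x, HasDerivAt f (f' x) x) (h' : HasDerivAt f' c a) (hm : IsLocalMin f a) : 0 ≤ c := by
  by_contra! hc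
  have hd := hasDerivAt_deriv_deriv h h'
  have hM := isLocalMax_of_deriv_deriv_neg (hd.trans_lt hc) hm.deriv_eq_zero (h a).continuousAt
  have he : f =ᶠ[𝓝 a] fun _ => f a := by
    filter_upwards [hm, hM] with x h1 h2 using le_antisymm h2 h1
  have := he.deriv.deriv_eq
  rw [hd] at this
  simp only [deriv_const', deriv_const] at this
  exact hc.ne this

theorem second_deriv_nonpos_of_isLocalMax {f f' : ℝ → ℝ} {a c : ℝ}
    (h : ∀ x, HasDerivAt f (f' x) x) (h' : HasDerivAt f' c a) (hm : IsLocalMax f a) : c ≤ 0 := by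
  have := second_deriv_nonneg_of_isLocalMin (f := fun x => -f x) (f' := fun x => -f' x)
    (fun x => (h x).neg) h'.neg hm.neg
  linarith

/-- Uniqueness for a linear second order equation with vanishing Cauchy data. -/
theorem eq_zero_of_linear_second_order {u v q : ℝ → ℝ} (hq : Continuous q)
    (hu : ∀ x, HasDerivAt u (v x) x) (hv : ∀ x, HasDerivAt v (q x * u x) x) {a : ℝ}
    (h0 : u a = 0) (h1 : v a = 0) (x : ℝ) : u x = 0 := by
  set R := |x - a| + 1
  have hR : 0 < R := by positivity
  obtain ⟨K, hK⟩ := (isCompact_Icc (a := a - R) (b := a + R)).exists_bound_of_continuousOn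
    hq.continuousOn
  have hK0 : 0 ≤ K := (norm_nonneg _).trans (hK a ⟨by linarith, by linarith⟩)
  -- The pair (u, v) solves a linear first order system, Lipschitz with constant max(1, K) in the
  -- sup norm, and is compared with the zero solution.
  have hE := ODE_solution_unique_of_mem_Ioo (v := fun t (y : ℝ × ℝ) => (y.2, q t * y.1))
    (s := fun _ => univ) (K := ⟨max 1 K, by positivity⟩) (a := a - R) (b := a + R) (t₀ := a)
    (f := fun t => (u t, v t)) (g := fun _ => (0, 0)) ?_ ⟨by linarith, by linarith⟩
    (fun t _ => ⟨(hu t).prodMk (hv t), mem_univ _⟩)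
    (fun t _ => ⟨by
      have := hasDerivAt_const t ((0:ℝ), (0:ℝ))
      rw [mul_zero]
      exact this, mem_univ _⟩) (by simp [h0, h1])
  · have hx : x ∈ Ioo (a - R) (a + R) :=
      ⟨by linarith [neg_abs_le (x - a)], by linarith [le_abs_self (x - a)]⟩
    have := hE hx
    simp only [Prod.mk.injEq] at this
    exact this.1
  · intro t ht
    refine LipschitzOnWith.of_dist_le_mul fun y _ z _ => ?_
    have hqt := hK t ⟨ht.1.le, ht.2.le⟩
    simp only [Prod.dist_eq, Real.dist_eq, ← mul_sub, abs_mul]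
    rw [Real.norm_eq_abs] at hqt
    set m := max |y.1 - z.1| |y.2 - z.2|
    have m1 : |y.1 - z.1| ≤ m := le_max_left _ _
    have m2 : |y.2 - z.2| ≤ m := le_max_right _ _
    have m0 : 0 ≤ m := (abs_nonneg _).trans m1
    refine max_le ?_ ?_
    · calc |y.2 - z.2| ≤ 1 * m := by linarith
        _ ≤ _ := mul_le_mul_of_nonneg_right (le_max_left _ _) m0
    · exact mul_le_mul (hqt.trans (le_max_right _ _)) m1 (abs_nonneg _)
        (zero_le_one.trans (le_max_left _ _))

/-- In terms of a = √(1 + 2λρ) the derivative is (3a - 1/a)/2, increasing in a. -/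
theorem nonlinDeriv_mono (hlam : 0 < lam) {ρ σ : ℝ} (hρ : 0 ≤ ρ) (h : ρ ≤ σ) :
    nonlinDeriv lam ρ ≤ nonlinDeriv lam σ := by
  have ha := one_le_sqrt_amplitude hlam hρ
  have ha2 : √(1 + 2 * lam * ρ) ^ 2 = 1 + 2 * lam * ρ := Real.sq_sqrt (by positivity)
  have hb2 : √(1 + 2 * lam * σ) ^ 2 = 1 + 2 * lam * σ :=
    Real.sq_sqrt (by have := hρ.trans h; positivity)
  have hab : √(1 + 2 * lam * ρ) ≤ √(1 + 2 * lam * σ) := by gcongr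
  unfold nonlinDeriv
  rw [show 1 + 3 * lam * ρ = (3 * √(1 + 2 * lam * ρ) ^ 2 - 1) / 2 by rw [ha2]; ring,
    show 1 + 3 * lam * σ = (3 * √(1 + 2 * lam * σ) ^ 2 - 1) / 2 by rw [hb2]; ring]
  generalize √(1 + 2 * lam * ρ) = a at *
  generalize √(1 + 2 * lam * σ) = b at *
  rw [div_le_div_iff₀ (by linarith) (by linarith)]
  nlinarith [mul_nonneg (sub_nonneg.2 hab) (by nlinarith : 0 ≤ 3 * (a * b) + 1)]

/-! ### Positivity, symmetry and monotonicity of the profile. -/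

namespace IsRealProfile

variable {μ : ℝ} {φ : L2} {u v : ℝ → ℝ}

theorem continuous (h : IsRealProfile C lam μ φ u v) : Continuous u :=
  continuous_of_hasDerivAt h.hasDerivAt

theorem continuous' (h : IsRealProfile C lam μ φ u v) : Continuous v :=
  continuous_of_hasDerivAt h.hasDerivAt'

/-- A zero of u ≥ 0 is a minimum, so u' vanishes there too. With its coefficient frozen the equation
is linear in u, hence u would vanish identically, against unit charge. -/
theorem pos (hlam : 0 < lam) (h : IsRealProfile C lam μ φ u v) (hφ : φ ∈ Sigma1) (x : ℝ) :
    0 < u x := by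
  refine lt_of_le_of_ne (h.nonneg x) fun h0 => ?_
  have hv0 : v x = 0 := IsLocalMin.hasDerivAt_eq_zero
    (Eventually.of_forall fun y => by rw [← h0]; exact h.nonneg y) (h.hasDerivAt x)
  have hq : Continuous fun x => x ^ 2 + C * nonlinDeriv lam (u x ^ 2) - μ :=
    ((continuous_pow 2).add (continuous_const.mul
      ((continuous_nonlinDeriv_sq hlam.le).comp h.continuous))).sub continuous_const
  have hz := eq_zero_of_linear_second_order hq h.hasDerivAt h.hasDerivAt' h0.symm hv0
  have : φ = 0 := by
    rw [Lp.eq_zero_iff_ae_eq_zero]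
    filter_upwards [h.ae_eq] with s hs
    rw [hs, hz, Complex.ofReal_zero, Pi.zero_apply]
  have h1 := norm_eq_one_of_mem_Sigma1 hφ
  rw [this, norm_zero] at h1
  exact zero_ne_one h1

/-- The reflected profile is again a nonnegative ground state, and there is only one. -/
theorem even (hC : 0 < C) (hlam : 0 < lam) (h : IsRealProfile C lam μ φ u v)
    (hφ : φ ∈ groundStates C lam) (x : ℝ) : u (-x) = u x := by
  have hX := hφ.1.1
  have i1 : Integrable fun s => ‖(u s : ℂ)‖ ^ 2 := (integrable_norm_sq φ).congr (by
    filter_upwards [h.ae_eq] with s hs; rw [hs])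
  have i2 : Integrable fun s => ‖(v s : ℂ)‖ ^ 2 := (integrable_norm_sq (weakDeriv φ)).congr (by
    filter_upwards [h.weakDeriv_ae_eq] with s hs; rw [hs])
  have i3 : Integrable fun s : ℝ => s ^ 2 * ‖(u s : ℂ)‖ ^ 2 := (integrable_weight hX).congr (by
    filter_upwards [h.ae_eq] with s hs; rw [hs])
  have hP : IsPrimitive (fun s => ((u (-s) : ℝ) : ℂ)) (fun s => ((-v (-s) : ℝ) : ℂ)) := by
    have hv := h.continuous'
    refine isPrimitive_of_hasDerivAt (fun s => ?_) (by fun_prop)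
    have := (h.hasDerivAt (-s)).scomp s (hasDerivAt_neg s)
    simp only [smul_eq_mul, neg_mul, one_mul] at this
    exact this.ofReal_comp
  obtain ⟨χ, hχ, h1, h2⟩ := exists_mem_X_of_isPrimitive hP i1.comp_neg
    (by simpa using i2.comp_neg) (by simpa using i3.comp_neg)
  have hcharge : charge χ = charge φ := by
    have e1 : charge χ = ∫ s, ‖((u (-s) : ℝ) : ℂ)‖ ^ 2 := integral_congr_ae (by
      filter_upwards [h1] with s hs; rw [hs])
    have e2 : charge φ = ∫ s, ‖((u s : ℝ) : ℂ)‖ ^ 2 := integral_congr_ae (by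
      filter_upwards [h.ae_eq] with s hs; rw [hs])
    rw [e1, e2]
    exact integral_neg_eq_self (fun s => ‖((u s : ℝ) : ℂ)‖ ^ 2) volume
  have henergy : energy C lam χ = energy C lam φ := by
    rw [energy_eq_integral C hlam.le hχ, energy_eq_integral C hlam.le hX]
    set e : ℝ → ℝ := fun s => ‖(v s : ℂ)‖ ^ 2 + s ^ 2 * ‖(u s : ℂ)‖ ^ 2 +
      C * nonlin lam (‖(u s : ℂ)‖ ^ 2)
    have e1 : ∫ s, energyDensity C lam χ s = ∫ s, e (-s) := integral_congr_ae (by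
      filter_upwards [h1, h2] with s h3 h4
      simp only [energyDensity, e, h3, h4, Complex.ofReal_neg, norm_neg, neg_sq])
    have e2 : ∫ s, energyDensity C lam φ s = ∫ s, e s := integral_congr_ae (by
      filter_upwards [h.ae_eq, h.weakDeriv_ae_eq] with s h3 h4
      simp only [energyDensity, e, h3, h4])
    rw [e1, e2, integral_neg_eq_self e volume]
  have hχg : χ ∈ groundStates C lam :=
    ⟨⟨hχ, hcharge.trans hφ.1.2⟩, henergy.trans hφ.2⟩
  have heq : χ = φ := eq_of_isNonneg_of_mem_groundStates hC hlam hχg hφ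
    (isNonneg_of_ae_eq (fun s => h.nonneg (-s)) h1) (isNonneg_of_ae_eq h.nonneg h.ae_eq)
  rw [heq] at h1
  refine eq_of_ae_eq_of_continuous (h.continuous.comp continuous_neg) h.continuous ?_ x
  filter_upwards [h1, h.ae_eq] with s h3 h4
  rw [h3] at h4
  exact Complex.ofReal_injective h4

theorem tendsto_sq (h : IsRealProfile C lam μ φ u v) :
    Tendsto (fun s => u s ^ 2) atTop (𝓝 0) := by
  have i1 : Integrable fun s => u s ^ 2 := (integrable_norm_sq φ).congr (by
    filter_upwards [h.ae_eq] with s hs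
    rw [hs, Complex.norm_real, Real.norm_eq_abs, sq_abs])
  have i2 : Integrable fun s => v s ^ 2 := (integrable_norm_sq (weakDeriv φ)).congr (by
    filter_upwards [h.weakDeriv_ae_eq] with s hs
    rw [hs, Complex.norm_real, Real.norm_eq_abs, sq_abs])
  have hu := h.continuous
  have hv := h.continuous'
  have i3 : Integrable fun s => 2 * u s * v s := by
    refine (i1.add i2).mono (by fun_prop) (ae_of_all _ fun s => ?_)
    rw [Pi.add_apply, Real.norm_eq_abs, Real.norm_of_nonneg (by positivity), abs_le]
    constructor <;> nlinarith [sq_nonneg (u s + v s), sq_nonneg (u s - v s)]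
  refine tendsto_zero_of_hasDerivAt_of_integrableOn_Ioi (a := 0) (fun x _ => ?_)
    i3.integrableOn i1.integrableOn
  have := (h.hasDerivAt x).pow 2
  simp only [Nat.cast_ofNat, Nat.add_one_sub_one, pow_one] at this
  exact this

/-- If u fails to decrease strictly, it has a local maximum at some b > 0 and a local minimum at
some a with |a| < b and u(a) ≤ u(b). With q(x) = x² + C f'(u(x)²) - μ and u'' = qu, the second
derivative tests give q(a) ≥ 0 ≥ q(b), whereas a² < b² and the monotonicity of f' give q(a) < q(b).
-/
theorem strictAntiOn (hC : 0 < C) (hlam : 0 < lam) (h : IsRealProfile C lam μ φ u v)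
    (hφ : φ ∈ groundStates C lam) : StrictAntiOn u (Ici 0) := by
  have hpos := h.pos hlam hφ.1
  have heven := h.even hC hlam hφ
  intro x hx y _ hxy
  by_contra! hle
  -- The maximum over [x, ∞) exists by decay at infinity. If it is attained at x, then u(x) ≤ u(y)
  -- makes y a maximum point as well.
  obtain ⟨b, hxb, hb⟩ : ∃ b, x < b ∧ ∀ z, x ≤ z → u z ≤ u b := by
    obtain ⟨T, hT⟩ := eventually_atTop.1
      (h.tendsto_sq.eventually_lt_const (pow_pos (hpos y) 2))
    have hxT : x ≤ max y T := hxy.le.trans (le_max_left _ _)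
    obtain ⟨b, hb, hbmax⟩ := (isCompact_Icc (a := x) (b := max y T)).exists_isMaxOn
      ⟨x, left_mem_Icc.2 hxT⟩ h.continuous.continuousOn
    have hyb : u y ≤ u b := hbmax ⟨hxy.le, le_max_left _ _⟩
    have hall : ∀ z, x ≤ z → u z ≤ u b := fun z hz => by
      rcases le_total z (max y T) with hzT | hzT
      · exact hbmax ⟨hz, hzT⟩
      · have := hT z ((le_max_right _ _).trans hzT)
        exact (lt_of_pow_lt_pow_left₀ 2 (h.nonneg y) this).le.trans hyb
    rcases hb.1.eq_or_lt with rfl | hxb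
    · exact ⟨y, hxy, fun z hz => (hall z hz).trans hle⟩
    · exact ⟨b, hxb, hall⟩
  have hx0 : 0 ≤ x := hx
  obtain ⟨a, ha, hamin⟩ : ∃ a ∈ Ioo (-b) b, ∀ z ∈ Icc (-b) b, u a ≤ u z := by
    obtain ⟨a, ha, hamin⟩ := (isCompact_Icc (a := -b) (b := b)).exists_isMinOn
      ⟨b, right_mem_Icc.2 (by linarith)⟩ h.continuous.continuousOn
    by_cases hab : a ∈ Ioo (-b) b
    · exact ⟨a, hab, hamin⟩
    · have : u a = u b := by
        have : a = -b ∨ a = b := by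
          by_contra! hne
          exact hab ⟨lt_of_le_of_ne ha.1 hne.1.symm, lt_of_le_of_ne ha.2 hne.2⟩
        rcases this with rfl | rfl
        · exact heven b
        · rfl
      -- A minimum over [-b, b] attained at an end point equals u(b) by evenness; since u(x) ≤ u(b),
      -- the interior point x attains it too.
      refine ⟨x, ⟨by linarith, hxb⟩, fun z hz => ?_⟩
      exact (hb x le_rfl).trans (this ▸ hamin hz)
  have hca := second_deriv_nonneg_of_isLocalMin h.hasDerivAt (h.hasDerivAt' a) (by
    filter_upwards [Ioo_mem_nhds ha.1 ha.2] with z hz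
    exact hamin z (Ioo_subset_Icc_self hz))
  have hcb := second_deriv_nonpos_of_isLocalMax h.hasDerivAt (h.hasDerivAt' b) (by
    filter_upwards [Ioi_mem_nhds hxb] with z hz
    exact hb z (le_of_lt hz))
  have qa := nonneg_of_mul_nonneg_left hca (hpos a)
  have qb := nonpos_of_mul_nonpos_left hcb (hpos b)
  have hab : a ^ 2 < b ^ 2 := sq_lt_sq' ha.1 ha.2
  have huab : u a ≤ u b := hamin b (right_mem_Icc.2 (by linarith))
  have hmono := mul_le_mul_of_nonneg_left (nonlinDeriv_mono hlam (sq_nonneg (u a))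
    (pow_le_pow_left₀ (h.nonneg a) huab 2)) hC.le
  linarith

theorem le_zero (hC : 0 < C) (hlam : 0 < lam) (h : IsRealProfile C lam μ φ u v)
    (hφ : φ ∈ groundStates C lam) (x : ℝ) : u x ≤ u 0 := by
  have : u |x| = u x := by
    rcases abs_choice x with hx | hx <;> rw [hx]
    exact h.even hC hlam hφ x
  rw [← this]
  exact (h.strictAntiOn hC hlam hφ).antitoneOn (mem_Ici.2 le_rfl) (mem_Ici.2 (abs_nonneg x))
    (abs_nonneg x)

/-! ### Ground states up to phase. -/

/-- Every ground state is a constant phase times the positive one. -/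
theorem exists_eq_exp_smul (hC : 0 < C) (hlam : 0 < lam) (h : IsRealProfile C lam μ φ u v)
    (hφ : φ ∈ groundStates C lam) {ψ : L2} (hψ : ψ ∈ groundStates C lam) :
    ∃ θ : ℝ, ψ = Complex.exp (Complex.I * θ) • φ := by
  have hpos := h.pos hlam hφ.1
  obtain ⟨ν, U, V, hU, hV, hUV, hVV⟩ := exists_classical_solution hC.le hlam hψ
  have hUc := continuous_of_hasDerivAt hUV
  have hVc := continuous_of_hasDerivAt hVV
  have hvc := h.continuous'
  have hnorm : ∀ x, ‖U x‖ = u x := eq_of_ae_eq_of_continuous hUc.norm h.continuous (by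
    filter_upwards [hU, h.ae_eq, norm_ae_eq_of_mem_groundStates hC hlam hψ hφ] with s h1 h2 h3
    rw [← h1, h3, h2, Complex.norm_real, Real.norm_of_nonneg (h.nonneg s)])
  have hre : ∀ x, (V x * starRingEnd ℂ (U x)).re = u x * v x := fun x => by
    have h1 := normSq_hasDerivAt (hUV x)
    simp only [hnorm] at h1
    have h2 := (h.hasDerivAt x).pow 2
    have h3 := h1.unique h2
    simp only [Nat.cast_ofNat, Nat.add_one_sub_one, pow_one] at h3
    linarith
  -- The diamagnetic inequality |(|U|)'| ≤ |U'|, with |U| = u; the steps below show that equality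
  -- holds everywhere.
  have hle : ∀ x, v x ^ 2 ≤ ‖V x‖ ^ 2 := fun x => by
    have h1 := re_mul_conj_sq_le (V x) (U x)
    rw [hre, hnorm, abs_mul, abs_of_pos (hpos x), mul_comm] at h1
    rw [← sq_abs]
    exact pow_le_pow_left₀ (abs_nonneg _) (le_of_mul_le_mul_right h1 (hpos x)) 2
  -- The other two terms of the energy depend only on the modulus.
  have hint : ∫ s, ‖weakDeriv ψ s‖ ^ 2 = ∫ s, ‖weakDeriv φ s‖ ^ 2 := by
    have h1 := hψ.2.trans hφ.2.symm
    have h2 := norm_ae_eq_of_mem_groundStates hC hlam hψ hφ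
    have h3 : ∫ s : ℝ, s ^ 2 * ‖ψ s‖ ^ 2 = ∫ s : ℝ, s ^ 2 * ‖φ s‖ ^ 2 :=
      integral_congr_ae (by filter_upwards [h2] with s hs; rw [hs])
    have h4 : ∫ s, √(1 + 2 * lam * ‖ψ s‖ ^ 2) * ‖ψ s‖ ^ 2 =
        ∫ s, √(1 + 2 * lam * ‖φ s‖ ^ 2) * ‖φ s‖ ^ 2 :=
      integral_congr_ae (by filter_upwards [h2] with s hs; rw [hs])
    unfold energy at h1
    rw [h3, h4] at h1
    linarith
  have heq : ∀ x, ‖V x‖ ^ 2 = v x ^ 2 := by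
    refine eq_of_ae_eq_of_continuous (by fun_prop) (by fun_prop) ?_
    have i1 := integrable_norm_sq (weakDeriv ψ)
    have i2 := integrable_norm_sq (weakDeriv φ)
    have h0 : ∫ s, ((fun s => ‖weakDeriv ψ s‖ ^ 2) - fun s => ‖weakDeriv φ s‖ ^ 2) s = 0 := by
      rw [integral_sub' i1 i2, hint, sub_self]
    rw [integral_eq_zero_iff_of_nonneg_ae _ (i1.sub i2)] at h0
    · filter_upwards [h0, hV, h.weakDeriv_ae_eq] with s h1 h2 h3
      rw [Pi.zero_apply, Pi.sub_apply, h2, h3, Complex.norm_real, Real.norm_eq_abs, sq_abs] at h1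
      linarith
    · filter_upwards [hV, h.weakDeriv_ae_eq] with s h2 h3
      rw [Pi.zero_apply, Pi.sub_apply, h2, h3, Complex.norm_real, Real.norm_eq_abs, sq_abs]
      linarith [hle s]
  -- Equality makes the modulus of V·conj U equal to that of its real part, so V·conj U is the real
  -- number uv. This identity is the vanishing of the numerator of (U/u)'.
  have hprop : ∀ x, V x * u x = U x * v x := fun x => by
    have h1 : ‖V x * starRingEnd ℂ (U x)‖ ^ 2 = (V x * starRingEnd ℂ (U x)).re ^ 2 := by
      rw [hre, norm_mul, mul_pow, heq, RCLike.norm_conj, hnorm]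
      ring
    have h2 : (V x * starRingEnd ℂ (U x)).im = 0 := by
      rw [Complex.sq_norm, Complex.normSq_apply] at h1
      nlinarith
    have h3 : V x * starRingEnd ℂ (U x) = (u x : ℂ) * v x := by
      rw [← Complex.ofReal_mul]
      exact Complex.ext (hre x) h2
    have h4 : starRingEnd ℂ (U x) * U x = (u x : ℂ) ^ 2 := by
      rw [mul_comm, Complex.mul_conj, Complex.normSq_eq_norm_sq, hnorm, Complex.ofReal_pow]
    have hux : (u x : ℂ) ≠ 0 := Complex.ofReal_ne_zero.2 (hpos x).ne'
    refine mul_left_cancel₀ hux ?_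
    calc (u x : ℂ) * (V x * u x) = V x * (starRingEnd ℂ (U x) * U x) := by rw [h4]; ring
      _ = (u x : ℂ) * v x * U x := by rw [← mul_assoc, h3]
      _ = _ := by ring
  have hconst : ∀ x, U x / u x = U 0 / u 0 := by
    have hd : ∀ x, HasDerivAt (fun x => U x / (u x : ℂ)) 0 x := fun x => by
      have := (hUV x).div (h.hasDerivAt x).ofReal_comp (Complex.ofReal_ne_zero.2 (hpos x).ne')
      rwa [hprop, sub_self, zero_div] at this
    exact fun x => is_const_of_deriv_eq_zero (fun x => (hd x).differentiableAt)
      (fun x => (hd x).deriv) x 0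
  have hc1 : ‖U 0 / (u 0 : ℂ)‖ = 1 := by
    rw [norm_div, hnorm, Complex.norm_real, Real.norm_of_nonneg (h.nonneg 0),
      div_self (hpos 0).ne']
  obtain ⟨θ, hθ⟩ := (Complex.norm_eq_one_iff _).1 hc1
  refine ⟨θ, Lp.ext ?_⟩
  filter_upwards [hU, h.ae_eq, Lp.coeFn_smul (Complex.exp (Complex.I * θ)) φ] with s h1 h2 h3
  rw [h1, h3, Pi.smul_apply, h2, mul_comm Complex.I, hθ, ← hconst s, smul_eq_mul,
    div_mul_cancel₀ _ (Complex.ofReal_ne_zero.2 (hpos s).ne')]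

end IsRealProfile

theorem smul_mem_groundStates {ψ : L2} (h : ψ ∈ groundStates C lam) {c : ℂ} (hc : ‖c‖ = 1) :
    c • ψ ∈ groundStates C lam := by
  refine ⟨⟨smul_mem_X h.1.1 c, ?_⟩, ?_⟩
  · rw [charge_smul, hc, one_pow, one_mul, h.1.2]
  · have hn : ∀ χ : L2, ∀ᵐ s, ‖(c • χ) s‖ = ‖χ s‖ := fun χ => by
      filter_upwards [Lp.coeFn_smul c χ] with s hs
      rw [hs, Pi.smul_apply, norm_smul, hc, one_mul]
    rw [← h.2]
    unfold energy
    rw [weakDeriv_smul h.1.1.1]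
    congr 1
    · congr 1
      · refine integral_congr_ae ?_
        filter_upwards [hn (weakDeriv ψ)] with s hs
        rw [hs]
      · refine integral_congr_ae ?_
        filter_upwards [hn ψ] with s hs
        rw [hs]
    · congr 1
      refine integral_congr_ae ?_
      filter_upwards [hn ψ] with s hs
      rw [hs]

end MunozDelgado

end

theorem theorem2p6 (C lam : ℝ) (hC : 0 < C) (hlam : 0 < lam) :
    ∃ φ ∈ MunozDelgado.groundStates C lam,
      (∃ u : ℝ → ℝ, Continuous u ∧ (∀ᵐ s : ℝ, φ s = (u s : ℂ)) ∧
        (∀ s, 0 < u s) ∧ (∀ s, u (-s) = u s) ∧ StrictAntiOn u (Set.Ici 0) ∧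
        (∀ s, u s ≤ u 0)) ∧
      (∀ χ ∈ MunozDelgado.groundStates C lam,
        (∀ᵐ s : ℝ, 0 ≤ (χ s).re ∧ (χ s).im = 0) → χ = φ) ∧
      MunozDelgado.groundStates C lam =
        {ψ | ∃ θ : ℝ, ψ = Complex.exp (Complex.I * θ) • φ} := by
  obtain ⟨φ, hφ, hn⟩ := MunozDelgado.exists_isNonneg_mem_groundStates hC hlam
  obtain ⟨μ, u, v, h⟩ := MunozDelgado.exists_isRealProfile hC.le hlam hφ hn
  refine ⟨φ, hφ, ⟨u, h.continuous, h.ae_eq, h.pos hlam hφ.1, h.even hC hlam hφ,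
    h.strictAntiOn hC hlam hφ, h.le_zero hC hlam hφ⟩, fun χ hχ hχn => ?_, ?_⟩
  · refine MunozDelgado.eq_of_isNonneg_of_mem_groundStates hC hlam hχ hφ ?_ hn
    filter_upwards [hχn] with s hs
    have : χ s = ((χ s).re : ℂ) := Complex.ext rfl (by simpa using hs.2)
    rw [this, Complex.norm_real, Real.norm_of_nonneg hs.1]
  · ext ψ
    refine ⟨fun hψ => h.exists_eq_exp_smul hC hlam hφ hψ, ?_⟩
    rintro ⟨θ, rfl⟩
    refine MunozDelgado.smul_mem_groundStates hφ ?_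
    rw [mul_comm, Complex.norm_exp_ofReal_mul_I]
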